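/- Let $M\ge 0$ be an integer, $\alpha>0$, $\rho(1),\dots,\rho(M)>0$, and let $F_0$ be a probability measure on $\mathbb R$ with Lebesgue density $f_0$ and quantile function $F_0^{-1}$, where $F_0^{-1}(0)=-\infty$ and $F_0^{-1}(1)=\infty$. For $1\le m\le M$ and $1\le j\le 2^m$ put $B_{mj}=\left(F_0^{-1}\left(\frac{j-1}{2^m}\right),F_0^{-1}\left(\frac{j}{2^m}\right)\right]\cap\mathbb R$, and for $x\in\mathbb R$ let $j_m^{(x)}$ be the index $j$ with $x\in B_{mj}$. Let $Y_{m,2j-1}$ ($1\le m\le M$, $1\le j\le 2^{m-1}$) be independent random variables with $Y_{m,2j-1}\sim\mathrm{Beta}(\alpha\rho(m),\alpha\rho(m))$, and let $Y_{m,2j}=1-Y_{m,2j-1}$. Let $F\sim\mathcal{PT}_M(\alpha,\rho,F_0)$ be the finite Pólya tree with these branching probabilities, that is, the random probability measure which almost surely has the Lebesgue density $$f(x)=\Big(\prod_{m=1}^M Y_{m,j_m^{(x)}}\Big)\,2^M f_0(x).$$ Then, almost surely, the integral $\mathrm{KL}(f\|f_0)=\int_{\mathbb R}\log\left\{\frac{f(x)}{f_0(x)}\right\}f(x)\,dx$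 (with integrand $0$ where $f(x)=0$) converges absolutely and $$\mathrm{KL}(f\|f_0)=\sum_{m=1}^M\sum_{j=1}^{2^m}(\log Y_{mj})\prod_{k=1}^{m}Y_{m-k+1,\,j_{m-k+1}^{(m,j)}}+M\log 2,$$ where $j_m^{(m,j)}=j$ and $j_{k-1}^{(m,j)}=\lceil j_k^{(m,j)}/2\rceil$. The random variable $\mathrm{KL}(f\|f_0)$ is square integrable, with mean $$\mathrm E\{\mathrm{KL}(f\|f_0)\}=\sum_{m=1}^M\left\{\psi_0(\alpha\rho(m)+1)-\psi_0(2\alpha\rho(m)+1)+\log 2\right\}$$ and variance $\mathrm{Var}\{\mathrm{KL}(f\|f_0)\}=A+B$, where $\psi_0=\Gamma'/\Gamma$ and $\psi_1=\psi_0'$ are the digamma and trigamma functions, $$A=\sum_{m=1}^M\left[\left\{\prod_{k=1}^m\frac{\alpha\rho(k)+1}{2\alpha\rho(k)+1}\right\}\lambda_5(m)-\left(\tfrac12\right)^m\lambda_2^2(m)\right],$$ $$\begin{aligned}B=\sum_{m=1}^M\Bigg(&\frac{\alpha\rho(m)}{2\alpha\rho(m)+1}\left\{\prod_{k=1}^{m-1}\frac{\alpha\rho(k)+1}{2\alpha\rho(k)+1}\right\}\lambda_6(m)-\left(\tfrac12\right)^m\lambda_2^2(m)\\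 &+\sum_{j=1}^{m-1}\left[\frac{\alpha\rho(j)}{2\alpha\rho(j)+1}\left\{\prod_{k=1}^{j-1}\frac{\alpha\rho(k)+1}{2\alpha\rho(k)+1}\right\}\lambda_2^2(m)-\left(\tfrac12\right)^j\lambda_2^2(m)\right]\\ &+2\left\{\prod_{k=1}^{m-1}\frac{\alpha\rho(k)+1}{2\alpha\rho(k)+1}\right\}\sum_{j=m+1}^{M}\left\{\frac{\alpha\rho(m)+1}{2\alpha\rho(m)+1}\lambda_3(m)\lambda_2(j)+\frac{\alpha\rho(m)}{2\alpha\rho(m)+1}\lambda_4(m)\lambda_2(j)-\lambda_2(m)\lambda_2(j)\right\}\Bigg),\end{aligned}$$ and $$\begin{aligned} \lambda_2(m)&=\psi_0(\alpha\rho(m)+1)-\psi_0(2\alpha\rho(m)+1),\\ \lambda_3(m)&=\psi_0(\alpha\rho(m)+2)-\psi_0(2\alpha\rho(m)+2),\\ \lambda_4(m)&=\psi_0(\alpha\rho(m)+1)-\psi_0(2\alpha\rho(m)+2),\\ \lambda_5(m)&=\psi_1(\alpha\rho(m)+2)-\psi_1(2\alpha\rho(m)+2)+\left\{\psi_0(\alpha\rho(m)+2)-\psi_0(2\alpha\rho(m)+2)\right\}^2,\\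 \lambda_6(m)&=\left\{\psi_0(\alpha\rho(m)+1)-\psi_0(2\alpha\rho(m)+2)\right\}^2-\psi_1(2\alpha\rho(m)+2). \end{aligned}$$ -/

import Mathlib

open MeasureTheory ProbabilityTheory

noncomputable section

namespace PolyaKL

/-- The real digamma function `ψ₀ = Γ' / Γ`. -/
def digamma : ℝ → ℝ := logDeriv Real.Gamma

/-- The real trigamma function `ψ₁ = ψ₀'`. -/
def trigamma : ℝ → ℝ := deriv digamma

/-- `f` is a (nonnegative, measurable) Lebesgue density of `μ`. -/
structure IsDensity (f : ℝ → ℝ) (μ : Measure ℝ) : Prop where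
  measurable : Measurable f
  nonneg : ∀ x, 0 ≤ f x
  eq_withDensity : μ = volume.withDensity (fun x => ENNReal.ofReal (f x))

/-- The integrand `log (f / g) * f` of the Kullback-Leibler divergence. -/
def klIntegrand (f g : ℝ → ℝ) (x : ℝ) : ℝ := Real.log (f x / g x) * f x

/-- The Kullback-Leibler divergence `KL(f || g)` between two densities. -/
def kl (f g : ℝ → ℝ) : ℝ := ∫ x, klIntegrand f g x

open Classical in
/-- The quantile function `F₀⁻¹` of `F₀`, with `F₀⁻¹(0) = -∞` and `F₀⁻¹(1) = ∞`. -/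
def quantile (F₀ : Measure ℝ) (u : ℝ) : EReal :=
  if u ≤ 0 then ⊥ else if 1 ≤ u then ⊤ else ((sInf {x : ℝ | u ≤ cdf F₀ x} : ℝ) : EReal)

/-- The partition set `B_{mj} = (F₀⁻¹((j-1)/2^m), F₀⁻¹(j/2^m)]`, for `1 ≤ j ≤ 2^m`. -/
def cell (F₀ : Measure ℝ) (m j : ℕ) : Set ℝ :=
  {x : ℝ | quantile F₀ (((j : ℝ) - 1) / 2 ^ m) < (x : EReal) ∧
    (x : EReal) ≤ quantile F₀ ((j : ℝ) / 2 ^ m)}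

/-- The (unique) `j` in `{1, …, 2^m}` such that `x` lies in `B_{mj}`. -/
def cellIndex (F₀ : Measure ℝ) (m : ℕ) (x : ℝ) : ℕ :=
  sInf {j : ℕ | 1 ≤ j ∧ j ≤ 2 ^ m ∧ x ∈ cell F₀ m j}

/-- The index `j_l^{(m,j)}` of the ancestor at level `l ≤ m` of the set `B_{mj}`: one starts
with `j` at level `m`, and each step upwards replaces `i` by `⌈i / 2⌉ = (i + 1) / 2`. -/
def ancestor (m j l : ℕ) : ℕ := (fun i : ℕ => (i + 1) / 2)^[m - l] j

/-- The density `f(x) = ∏_{m=1}^M Y_{m, j_m^{(x)}} 2^M f₀(x)` of a finite Pólya tree with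
branching probabilities `y`. -/
def treeDensity (M : ℕ) (F₀ : Measure ℝ) (f₀ : ℝ → ℝ) (y : ℕ → ℕ → ℝ) (x : ℝ) : ℝ :=
  (∏ m ∈ Finset.Icc 1 M, y m (cellIndex F₀ m x)) * 2 ^ M * f₀ x

/-- `F ∼ PT_M(α, ρ, F₀)` with branching probabilities `Y m j` (`1 ≤ m ≤ M`, `1 ≤ j ≤ 2^m`),
where `f₀` is the density of `F₀`.
The pair `⟨m, i⟩ : Σ m : Fin M, Fin (2 ^ m)` stands for level `m + 1` and
for the siblings `2 i + 1` and `2 i + 2` at that level. -/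
structure IsFinitePolyaTree {Ω : Type*} [MeasurableSpace Ω] (P : Measure Ω) (M : ℕ) (α : ℝ)
    (ρ : ℕ → ℝ) (F₀ : Measure ℝ) (f₀ : ℝ → ℝ) (Y : ℕ → ℕ → Ω → ℝ) (F : Ω → Measure ℝ) :
    Prop where
  measurable_left : ∀ p : (Σ m : Fin M, Fin (2 ^ (m : ℕ))),
    Measurable (Y ((p.1 : ℕ) + 1) (2 * (p.2 : ℕ) + 1))
  indep : iIndepFun (fun (p : (Σ m : Fin M, Fin (2 ^ (m : ℕ)))) =>
    Y ((p.1 : ℕ) + 1) (2 * (p.2 : ℕ) + 1)) P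
  law : ∀ p : (Σ m : Fin M, Fin (2 ^ (m : ℕ))),
    P.map (Y ((p.1 : ℕ) + 1) (2 * (p.2 : ℕ) + 1)) =
      betaMeasure (α * ρ ((p.1 : ℕ) + 1)) (α * ρ ((p.1 : ℕ) + 1))
  right : ∀ (p : (Σ m : Fin M, Fin (2 ^ (m : ℕ)))) (ω : Ω),
    Y ((p.1 : ℕ) + 1) (2 * (p.2 : ℕ) + 2) ω = 1 - Y ((p.1 : ℕ) + 1) (2 * (p.2 : ℕ) + 1) ω
  measurable : Measurable F
  isProbabilityMeasure : ∀ ω, IsProbabilityMeasure (F ω)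
  density : ∀ᵐ ω ∂P, F ω = volume.withDensity
    (fun x => ENNReal.ofReal (treeDensity M F₀ f₀ (fun m j => Y m j ω) x))

/-- `∑_{m=1}^M ∑_{j=1}^{2^m} (log Y_{mj}) ∏_{k=1}^m Y_{m-k+1, j_{m-k+1}^{(m,j)}} + M log 2`. -/
def reverseKLSum (M : ℕ) (y : ℕ → ℕ → ℝ) : ℝ :=
  (∑ m ∈ Finset.Icc 1 M, ∑ j ∈ Finset.Icc 1 (2 ^ m),
    Real.log (y m j) * ∏ k ∈ Finset.Icc 1 m, y (m - k + 1) (ancestor m j (m - k + 1)))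
  + M * Real.log 2

section Constants

variable (α : ℝ) (ρ : ℕ → ℝ)

def lambda2 (m : ℕ) : ℝ := digamma (α * ρ m + 1) - digamma (2 * α * ρ m + 1)

def lambda3 (m : ℕ) : ℝ := digamma (α * ρ m + 2) - digamma (2 * α * ρ m + 2)

def lambda4 (m : ℕ) : ℝ := digamma (α * ρ m + 1) - digamma (2 * α * ρ m + 2)

def lambda5 (m : ℕ) : ℝ :=
  trigamma (α * ρ m + 2) - trigamma (2 * α * ρ m + 2)
    + (digamma (α * ρ m + 2) - digamma (2 * α * ρ m + 2)) ^ 2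

def lambda6 (m : ℕ) : ℝ :=
  (digamma (α * ρ m + 1) - digamma (2 * α * ρ m + 2)) ^ 2 - trigamma (2 * α * ρ m + 2)

/-- `∏_{k=1}^m (α ρ(k) + 1) / (2 α ρ(k) + 1)`. -/
def ratioProd (m : ℕ) : ℝ :=
  ∏ k ∈ Finset.Icc 1 m, (α * ρ k + 1) / (2 * α * ρ k + 1)

def varA (M : ℕ) : ℝ :=
  ∑ m ∈ Finset.Icc 1 M,
    (ratioProd α ρ m * lambda5 α ρ m - (1 / 2 : ℝ) ^ m * lambda2 α ρ m ^ 2)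

def varB (M : ℕ) : ℝ :=
  ∑ m ∈ Finset.Icc 1 M,
    ((α * ρ m / (2 * α * ρ m + 1)) * ratioProd α ρ (m - 1) * lambda6 α ρ m
        - (1 / 2 : ℝ) ^ m * lambda2 α ρ m ^ 2
      + ∑ j ∈ Finset.Icc 1 (m - 1),
          ((α * ρ j / (2 * α * ρ j + 1)) * ratioProd α ρ (j - 1) * lambda2 α ρ m ^ 2
            - (1 / 2 : ℝ) ^ j * lambda2 α ρ m ^ 2)
      + 2 * ratioProd α ρ (m - 1) * ∑ j ∈ Finset.Icc (m + 1) M,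
          (((α * ρ m + 1) / (2 * α * ρ m + 1)) * lambda3 α ρ m * lambda2 α ρ j
            + (α * ρ m / (2 * α * ρ m + 1)) * lambda4 α ρ m * lambda2 α ρ j
            - lambda2 α ρ m * lambda2 α ρ j))

end Constants

end PolyaKL

end

/-!
The leaves of the tree have equal mass under `F₀`, so `KL(f ‖ f₀)` is `M log 2` minus the entropy of
the leaf masses. By the chain rule that entropy is the sum over the levels of the conditional
entropies `H_m = ∑ᵢ W_{m,i} h(Y_{m+1,2i+1})`, where `h` is the binary entropy and the node masses
`W_{m,i}` add up to one. Given the levels above it, `H_m` is thus a convex combination of i.i.d.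
variables: its conditional mean is constant, so the `H_m` are uncorrelated, and its variance is
`Var h(Y) · ∑ᵢ E W_{m,i}²`, where the sum is a product over the levels.

The moments of `h(Y)` come from the logarithm of `x ^ p (1 - x) ^ q` under a beta distribution,
whose cumulant generating function is a sum of log-gamma functions; the factors `x` and `1 - x` in
`h` merely shift the parameters of the distribution. In `A + B` the products of distinct levels
cancel, since `λ₂` is a mixture of `λ₃` and `λ₄`, and the remaining inner sums telescope.
-/

namespace PolyaKL

open Set Filter Topology

lemma contDiffAt_Gamma {x : ℝ} (hx : 0 < x) {n : WithTop ℕ∞} : ContDiffAt ℝ n Real.Gamma x := by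
  have differentiableOn : DifferentiableOn ℂ Complex.Gamma {z : ℂ | 0 < z.re} := by
    intro z (hz : 0 < z.re)
    refine (Complex.differentiableAt_Gamma z fun k hk => ?_).differentiableWithinAt
    rw [hk, Complex.neg_re, Complex.natCast_re] at hz
    exact absurd hz (by simp)
  have isOpen : IsOpen {z : ℂ | 0 < z.re} := isOpen_lt continuous_const Complex.continuous_re
  exact (differentiableOn.analyticAt
    (isOpen.mem_nhds (by simpa using hx))).contDiffAt.real_of_complex

lemma hasDerivAt_log_Gamma {x : ℝ} (hx : 0 < x) :
    HasDerivAt (fun y => Real.log (Real.Gamma y)) (digamma x) x :=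
  ((contDiffAt_Gamma hx (n := 1)).differentiableAt one_ne_zero).hasDerivAt.log
    (Real.Gamma_pos_of_pos hx).ne'

lemma hasDerivAt_digamma {x : ℝ} (hx : 0 < x) : HasDerivAt digamma (trigamma x) x := by
  have contDiffAt_deriv : ContDiffAt ℝ 1 (deriv Real.Gamma) x :=
    (contDiffAt_Gamma hx (n := 2)).derivWithin (by norm_num [one_add_one_eq_two])
  exact ((contDiffAt_deriv.differentiableAt one_ne_zero).div
    ((contDiffAt_Gamma hx (n := 1)).differentiableAt one_ne_zero)
    (Real.Gamma_pos_of_pos hx).ne').hasDerivAt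

lemma digamma_add_one {x : ℝ} (hx : 0 < x) : digamma (x + 1) = digamma x + 1 / x := by
  have log_Gamma_add_one : (fun y => Real.log (Real.Gamma (y + 1)))
      =ᶠ[𝓝 x] fun y => Real.log (Real.Gamma y) + Real.log y := by
    filter_upwards [lt_mem_nhds hx] with y hy
    rw [Real.Gamma_add_one hy.ne', Real.log_mul hy.ne' (Real.Gamma_pos_of_pos hy).ne', add_comm]
  rw [one_div]
  exact ((hasDerivAt_log_Gamma (by linarith : 0 < x + 1)).comp_add_const x 1).unique
    (((hasDerivAt_log_Gamma hx).add (Real.hasDerivAt_log hx.ne')).congr_of_eventuallyEq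
      log_Gamma_add_one)

lemma beta_comm (u v : ℝ) : beta u v = beta v u := by
  rw [beta, beta, mul_comm, add_comm]

lemma beta_add_one_left {u v : ℝ} (hu : 0 < u) (hv : 0 < v) :
    beta (u + 1) v = u / (u + v) * beta u v := by
  have huv : 0 < u + v := add_pos hu hv
  have Gamma_ne_zero := (Real.Gamma_pos_of_pos huv).ne'
  rw [beta, beta, Real.Gamma_add_one hu.ne', add_right_comm, Real.Gamma_add_one huv.ne']
  field_simp

lemma log_beta {u v : ℝ} (hu : 0 < u) (hv : 0 < v) :
    Real.log (beta u v) = Real.log (Real.Gamma u) + Real.log (Real.Gamma v)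
      - Real.log (Real.Gamma (u + v)) := by
  have hΓu := (Real.Gamma_pos_of_pos hu).ne'
  have hΓv := (Real.Gamma_pos_of_pos hv).ne'
  rw [beta, Real.log_div (mul_ne_zero hΓu hΓv) (Real.Gamma_pos_of_pos (add_pos hu hv)).ne',
    Real.log_mul hΓu hΓv]

section BetaDistribution

variable {u v : ℝ}

lemma betaPDFReal_nonneg (hu : 0 < u) (hv : 0 < v) (x : ℝ) : 0 ≤ betaPDFReal u v x := by
  by_cases hx : 0 < x ∧ x < 1
  · exact (betaPDFReal_pos hx.1 hx.2 hu hv).le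
  · exact (if_neg hx).ge

lemma betaPDFReal_one_sub (u v x : ℝ) : betaPDFReal u v (1 - x) = betaPDFReal v u x := by
  simp only [betaPDFReal, sub_pos, sub_lt_self_iff, and_comm, beta_comm u v, sub_sub_cancel]
  split_ifs <;> ring

lemma rpow_mul_rpow_mul_betaPDFReal (hu : 0 < u) (hv : 0 < v) {p q : ℝ} (hp : 0 < u + p)
    (hq : 0 < v + q) (x : ℝ) :
    x ^ p * (1 - x) ^ q * betaPDFReal u v x
      = beta (u + p) (v + q) / beta u v * betaPDFReal (u + p) (v + q) x := by
  have beta_ne_zero := (beta_pos hu hv).ne'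
  have beta_ne_zero' := (beta_pos hp hq).ne'
  simp only [betaPDFReal]
  split_ifs with hx
  · have h1x : 0 < 1 - x := by linarith
    rw [add_sub_right_comm u, add_sub_right_comm v, Real.rpow_add hx.1, Real.rpow_add h1x]
    field_simp
  · simp only [mul_zero]

lemma ae_mem_Ioo_betaMeasure (u v : ℝ) : ∀ᵐ x ∂betaMeasure u v, x ∈ Ioo (0 : ℝ) 1 := by
  refine (ae_withDensity_iff (measurable_betaPDFReal u v).ennreal_ofReal).2 (ae_of_all _ ?_)
  intro x hx
  by_contra h
  exact hx ((congrArg ENNReal.ofReal (if_neg h)).trans ENNReal.ofReal_zero)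

lemma integral_betaMeasure (hu : 0 < u) (hv : 0 < v) (g : ℝ → ℝ) :
    ∫ x, g x ∂betaMeasure u v = ∫ x, betaPDFReal u v x * g x := by
  rw [betaMeasure, integral_withDensity_eq_integral_toReal_smul (f := betaPDF u v)
    (measurable_betaPDFReal u v).ennreal_ofReal (ae_of_all _ fun _ => ENNReal.ofReal_lt_top)]
  simp only [betaPDF, ENNReal.toReal_ofReal (betaPDFReal_nonneg hu hv _), smul_eq_mul]

lemma integral_one_sub_betaMeasure (hu : 0 < u) (hv : 0 < v) (g : ℝ → ℝ) :
    ∫ x, g (1 - x) ∂betaMeasure u v = ∫ x, g x ∂betaMeasure v u := by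
  rw [integral_betaMeasure hu hv, integral_betaMeasure hv hu,
    ← integral_sub_left_eq_self (fun x => betaPDFReal v u x * g x) volume 1]
  simp only [betaPDFReal_one_sub]

lemma integral_rpow_mul_rpow_mul_betaMeasure (hu : 0 < u) (hv : 0 < v) {p q : ℝ}
    (hp : 0 < u + p) (hq : 0 < v + q) (g : ℝ → ℝ) :
    ∫ x, x ^ p * (1 - x) ^ q * g x ∂betaMeasure u v
      = beta (u + p) (v + q) / beta u v * ∫ x, g x ∂betaMeasure (u + p) (v + q) := by
  rw [integral_betaMeasure hu hv, integral_betaMeasure hp hq, ← integral_const_mul]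
  congr with x
  linear_combination g x * rpow_mul_rpow_mul_betaPDFReal hu hv hp hq x

/-- The logarithm of the monomial `x ^ p * (1 - x) ^ q` on the unit interval: a linear family
of variables whose exponential moments under beta distributions are ratios of beta functions. -/
noncomputable def logMonomial (p q x : ℝ) : ℝ := p * Real.log x + q * Real.log (1 - x)

lemma mgf_logMonomial_betaMeasure (hu : 0 < u) (hv : 0 < v) {p q t : ℝ} (hp : 0 < u + t * p)
    (hq : 0 < v + t * q) :
    mgf (logMonomial p q) (betaMeasure u v) t
      = beta (u + t * p) (v + t * q) / beta u v := by
  have := isProbabilityMeasureBeta hp hq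
  calc mgf (logMonomial p q) (betaMeasure u v) t
      = ∫ x, x ^ (t * p) * (1 - x) ^ (t * q) * 1 ∂betaMeasure u v := by
        refine integral_congr_ae ?_
        filter_upwards [ae_mem_Ioo_betaMeasure u v] with x hx
        rw [Real.rpow_def_of_pos hx.1, Real.rpow_def_of_pos (sub_pos.2 hx.2), ← Real.exp_add,
          logMonomial]
        ring_nf
    _ = beta (u + t * p) (v + t * q) / beta u v := by
        rw [integral_rpow_mul_rpow_mul_betaMeasure hu hv hp hq]
        simp

lemma eventually_pos_add_mul (hu : 0 < u) (p : ℝ) : ∀ᶠ t in 𝓝 (0 : ℝ), 0 < u + t * p :=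
  ContinuousAt.eventually_lt (by fun_prop) (by fun_prop) (by simpa using hu)

lemma zero_mem_interior_integrableExpSet_logMonomial (hu : 0 < u) (hv : 0 < v) (p q : ℝ) :
    (0 : ℝ) ∈ interior (integrableExpSet (logMonomial p q) (betaMeasure u v)) := by
  rw [mem_interior_iff_mem_nhds]
  filter_upwards [eventually_pos_add_mul hu p, eventually_pos_add_mul hv q] with t hp hq
  refine Integrable.of_integral_ne_zero (ne_of_gt ?_)
  calc 0 < beta (u + t * p) (v + t * q) / beta u v := div_pos (beta_pos hp hq) (beta_pos hu hv)
    _ = _ := (mgf_logMonomial_betaMeasure hu hv hp hq).symm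

lemma cgf_logMonomial_betaMeasure (hu : 0 < u) (hv : 0 < v) {p q t : ℝ} (hp : 0 < u + t * p)
    (hq : 0 < v + t * q) :
    cgf (logMonomial p q) (betaMeasure u v) t
      = Real.log (Real.Gamma (u + t * p)) + Real.log (Real.Gamma (v + t * q))
        - Real.log (Real.Gamma (u + v + t * (p + q))) - Real.log (beta u v) := by
  rw [cgf, mgf_logMonomial_betaMeasure hu hv hp hq,
    Real.log_div (beta_pos hp hq).ne' (beta_pos hu hv).ne', log_beta hp hq]
  ring_nf

lemma hasDerivAt_add_mul_const (a b t : ℝ) : HasDerivAt (fun s => a + s * b) b t := by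
  simpa using ((hasDerivAt_id t).mul_const b).const_add a

lemma deriv_cgf_logMonomial_betaMeasure (hu : 0 < u) (hv : 0 < v) (p q : ℝ) :
    deriv (cgf (logMonomial p q) (betaMeasure u v))
      =ᶠ[𝓝 0] fun t => digamma (u + t * p) * p + digamma (v + t * q) * q
        - digamma (u + v + t * (p + q)) * (p + q) := by
  have near_zero : ∀ᶠ t in 𝓝 (0 : ℝ), 0 < u + t * p ∧ 0 < v + t * q :=
    (eventually_pos_add_mul hu p).and (eventually_pos_add_mul hv q)
  filter_upwards [near_zero.eventually_nhds] with t ht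
  have cgf_eq := ht.mono fun s hs => cgf_logMonomial_betaMeasure hu hv hs.1 hs.2
  obtain ⟨hp, hq⟩ := ht.self_of_nhds
  have hpq : 0 < u + v + t * (p + q) := by linarith
  have hasDerivAt := ((((hasDerivAt_log_Gamma hp).comp t (hasDerivAt_add_mul_const u p t)).add
    ((hasDerivAt_log_Gamma hq).comp t (hasDerivAt_add_mul_const v q t))).sub
    ((hasDerivAt_log_Gamma hpq).comp t (hasDerivAt_add_mul_const (u + v) (p + q) t))).sub_const
    (Real.log (beta u v))
  exact (hasDerivAt.congr_of_eventuallyEq cgf_eq).deriv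

lemma memLp_logMonomial_betaMeasure (hu : 0 < u) (hv : 0 < v) (p q : ℝ) :
    MemLp (logMonomial p q) 2 (betaMeasure u v) :=
  memLp_of_mem_interior_integrableExpSet
    (zero_mem_interior_integrableExpSet_logMonomial hu hv p q) 2

lemma integral_logMonomial_betaMeasure (hu : 0 < u) (hv : 0 < v) (p q : ℝ) :
    ∫ x, logMonomial p q x ∂betaMeasure u v
      = p * digamma u + q * digamma v - (p + q) * digamma (u + v) := by
  have := isProbabilityMeasureBeta hu hv
  have mean_eq := deriv_cgf_zero (zero_mem_interior_integrableExpSet_logMonomial hu hv p q)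
  rw [probReal_univ, div_one, (deriv_cgf_logMonomial_betaMeasure hu hv p q).self_of_nhds] at mean_eq
  rw [← mean_eq]
  simp only [zero_mul, add_zero]
  ring

lemma variance_logMonomial_betaMeasure (hu : 0 < u) (hv : 0 < v) (p q : ℝ) :
    Var[logMonomial p q; betaMeasure u v]
      = p ^ 2 * trigamma u + q ^ 2 * trigamma v - (p + q) ^ 2 * trigamma (u + v) := by
  have := isProbabilityMeasureBeta hu hv
  have variance_eq :=
    variance_tilted_mul (zero_mem_interior_integrableExpSet_logMonomial hu hv p q)
  simp only [zero_mul, tilted_const] at variance_eq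
  have hasDerivAt_digamma_affine {a : ℝ} (ha : 0 < a) (b : ℝ) :
      HasDerivAt (fun t => digamma (a + t * b) * b) (trigamma a * b * b) 0 :=
    (HasDerivAt.comp_of_eq 0 (hasDerivAt_digamma ha) (hasDerivAt_add_mul_const a b 0)
      (by simp)).mul_const b
  rw [variance_eq, iteratedDeriv_succ, iteratedDeriv_one,
    (deriv_cgf_logMonomial_betaMeasure hu hv p q).deriv_eq,
    (((hasDerivAt_digamma_affine hu p).fun_add (hasDerivAt_digamma_affine hv q)).fun_sub
      (hasDerivAt_digamma_affine (add_pos hu hv) (p + q))).deriv]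
  ring

lemma integral_logMonomial_sq_betaMeasure (hu : 0 < u) (hv : 0 < v) (p q : ℝ) :
    ∫ x, logMonomial p q x ^ 2 ∂betaMeasure u v
      = p ^ 2 * trigamma u + q ^ 2 * trigamma v - (p + q) ^ 2 * trigamma (u + v)
        + (p * digamma u + q * digamma v - (p + q) * digamma (u + v)) ^ 2 := by
  have := isProbabilityMeasureBeta hu hv
  have variance_eq := variance_eq_sub (memLp_logMonomial_betaMeasure hu hv p q)
  rw [variance_logMonomial_betaMeasure hu hv, integral_logMonomial_betaMeasure hu hv] at variance_eq
  exact sub_eq_iff_eq_add.1 variance_eq.symm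

lemma integral_log_betaMeasure (hu : 0 < u) (hv : 0 < v) :
    ∫ x, Real.log x ∂betaMeasure u v = digamma u - digamma (u + v) := by
  simpa [logMonomial] using integral_logMonomial_betaMeasure hu hv 1 0

lemma integral_log_sq_betaMeasure (hu : 0 < u) (hv : 0 < v) :
    ∫ x, Real.log x ^ 2 ∂betaMeasure u v
      = trigamma u - trigamma (u + v) + (digamma u - digamma (u + v)) ^ 2 := by
  simpa [logMonomial] using integral_logMonomial_sq_betaMeasure hu hv 1 0

lemma integral_log_mul_log_one_sub_betaMeasure (hu : 0 < u) (hv : 0 < v) :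
    ∫ x, Real.log x * Real.log (1 - x) ∂betaMeasure u v
      = (digamma u - digamma (u + v)) * (digamma v - digamma (u + v)) - trigamma (u + v) := by
  have integrable_sq (p q : ℝ) : Integrable (fun x => logMonomial p q x ^ 2) (betaMeasure u v) :=
    (memLp_logMonomial_betaMeasure hu hv p q).integrable_sq
  have integrable_sub : Integrable (fun x => logMonomial 1 1 x ^ 2 - logMonomial 1 0 x ^ 2)
      (betaMeasure u v) := (integrable_sq 1 1).sub (integrable_sq 1 0)
  calc ∫ x, Real.log x * Real.log (1 - x) ∂betaMeasure u v
      = ∫ x, (logMonomial 1 1 x ^ 2 - logMonomial 1 0 x ^ 2 - logMonomial 0 1 x ^ 2) / 2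
          ∂betaMeasure u v := by
        congr with x
        simp only [logMonomial]
        ring
    _ = (digamma u - digamma (u + v)) * (digamma v - digamma (u + v)) - trigamma (u + v) := by
        rw [integral_div, integral_sub integrable_sub (integrable_sq 0 1),
          integral_sub (integrable_sq 1 1) (integrable_sq 1 0)]
        simp only [integral_logMonomial_sq_betaMeasure hu hv]
        ring

lemma beta_add_two_left_div_beta (hu : 0 < u) (hv : 0 < v) :
    beta (u + 2) v / beta u v = u * (u + 1) / ((u + v) * (u + v + 1)) := by
  have beta_ne_zero := (beta_pos hu hv).ne'
  rw [← one_add_one_eq_two, ← add_assoc, beta_add_one_left (by positivity) hv,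
    beta_add_one_left hu hv, add_right_comm]
  field_simp

lemma beta_add_one_add_one_div_beta (hu : 0 < u) (hv : 0 < v) :
    beta (u + 1) (v + 1) / beta u v = u * v / ((u + v) * (u + v + 1)) := by
  have beta_ne_zero := (beta_pos hu hv).ne'
  rw [beta_add_one_left hu (by positivity), beta_comm, beta_add_one_left hv hu, beta_comm v u]
  field_simp
  ring

lemma integral_sq_betaMeasure (hu : 0 < u) (hv : 0 < v) :
    ∫ x, x ^ 2 ∂betaMeasure u v = u * (u + 1) / ((u + v) * (u + v + 1)) := by
  have := isProbabilityMeasureBeta (by positivity : 0 < u + 2) hv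
  rw [← beta_add_two_left_div_beta hu hv]
  simpa using integral_rpow_mul_rpow_mul_betaMeasure (p := 2) (q := 0) hu hv (by positivity)
    (by simpa using hv) fun _ => 1

lemma integral_negMulLog_betaMeasure (hu : 0 < u) (hv : 0 < v) :
    ∫ x, Real.negMulLog x ∂betaMeasure u v
      = -(u / (u + v) * (digamma (u + 1) - digamma (u + v + 1))) := by
  have beta_ne_zero := (beta_pos hu hv).ne'
  have tilt := integral_rpow_mul_rpow_mul_betaMeasure (p := 1) (q := 0) hu hv (by positivity)
    (by simpa using hv) Real.log
  simp only [Real.rpow_one, Real.rpow_zero, mul_one, add_zero] at tilt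
  rw [integral_log_betaMeasure (by positivity) hv, beta_add_one_left hu hv,
    mul_div_cancel_right₀ _ beta_ne_zero, add_right_comm] at tilt
  simp only [Real.negMulLog, neg_mul, integral_neg, tilt]

lemma integral_negMulLog_sq_betaMeasure (hu : 0 < u) (hv : 0 < v) :
    ∫ x, Real.negMulLog x ^ 2 ∂betaMeasure u v
      = u * (u + 1) / ((u + v) * (u + v + 1)) * (trigamma (u + 2) - trigamma (u + v + 2)
        + (digamma (u + 2) - digamma (u + v + 2)) ^ 2) := by
  have tilt := integral_rpow_mul_rpow_mul_betaMeasure (p := 2) (q := 0) hu hv (by positivity)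
    (by simpa using hv) fun x => Real.log x ^ 2
  simp only [Real.rpow_two, Real.rpow_zero, mul_one, add_zero] at tilt
  rw [integral_log_sq_betaMeasure (by positivity) hv, beta_add_two_left_div_beta hu hv,
    add_right_comm u 2 v] at tilt
  simp only [Real.negMulLog, neg_mul, neg_sq, mul_pow, tilt]

lemma integral_negMulLog_mul_negMulLog_one_sub_betaMeasure (hu : 0 < u) (hv : 0 < v) :
    ∫ x, Real.negMulLog x * Real.negMulLog (1 - x) ∂betaMeasure u v
      = u * v / ((u + v) * (u + v + 1)) * ((digamma (u + 1) - digamma (u + v + 2))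
        * (digamma (v + 1) - digamma (u + v + 2)) - trigamma (u + v + 2)) := by
  have tilt := integral_rpow_mul_rpow_mul_betaMeasure (p := 1) (q := 1) hu hv (by positivity)
    (by positivity) fun x => Real.log x * Real.log (1 - x)
  simp only [Real.rpow_one] at tilt
  rw [integral_log_mul_log_one_sub_betaMeasure (by positivity) (by positivity),
    beta_add_one_add_one_div_beta hu hv, add_add_add_comm, one_add_one_eq_two] at tilt
  rw [← tilt]
  congr with x
  simp only [Real.negMulLog]
  ring

lemma integrable_betaMeasure_of_continuous (hu : 0 < u) (hv : 0 < v) {g : ℝ → ℝ}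
    (hg : Continuous g) : Integrable g (betaMeasure u v) := by
  have := isProbabilityMeasureBeta hu hv
  have integrableOn : IntegrableOn g (Icc 0 1) (betaMeasure u v) :=
    hg.continuousOn.integrableOn_compact isCompact_Icc
  rwa [IntegrableOn, Measure.restrict_eq_self_of_ae_mem
    ((ae_mem_Ioo_betaMeasure u v).mono fun _ hx => Ioo_subset_Icc_self hx)] at integrableOn

end BetaDistribution

section SymmetricBetaDistribution

variable {a : ℝ}

lemma integral_sq_add_one_sub_sq_betaMeasure (ha : 0 < a) :
    ∫ x, (x ^ 2 + (1 - x) ^ 2) ∂betaMeasure a a = (a + 1) / (2 * a + 1) := by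
  rw [integral_add (integrable_betaMeasure_of_continuous ha ha (by fun_prop))
      (integrable_betaMeasure_of_continuous ha ha (by fun_prop)),
    integral_one_sub_betaMeasure ha ha fun x => x ^ 2, integral_sq_betaMeasure ha ha]
  field_simp
  ring

lemma integral_binEntropy_betaMeasure (ha : 0 < a) :
    ∫ x, Real.binEntropy x ∂betaMeasure a a = -(digamma (a + 1) - digamma (2 * a + 1)) := by
  simp only [Real.binEntropy_eq_negMulLog_add_negMulLog_one_sub]
  rw [integral_add (integrable_betaMeasure_of_continuous ha ha (by fun_prop))
      (integrable_betaMeasure_of_continuous ha ha (by fun_prop)),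
    integral_one_sub_betaMeasure ha ha, integral_negMulLog_betaMeasure ha ha, ← two_mul a]
  field_simp
  ring

lemma integral_binEntropy_sq_betaMeasure (ha : 0 < a) :
    ∫ x, Real.binEntropy x ^ 2 ∂betaMeasure a a
      = (a + 1) / (2 * a + 1) * (trigamma (a + 2) - trigamma (2 * a + 2)
          + (digamma (a + 2) - digamma (2 * a + 2)) ^ 2)
        + a / (2 * a + 1) * ((digamma (a + 1) - digamma (2 * a + 2)) ^ 2
          - trigamma (2 * a + 2)) := by
  have integrable {g : ℝ → ℝ} (hg : Continuous g) : Integrable g (betaMeasure a a) :=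
    integrable_betaMeasure_of_continuous ha ha hg
  calc ∫ x, Real.binEntropy x ^ 2 ∂betaMeasure a a
      = ∫ x, (Real.negMulLog x ^ 2 + Real.negMulLog (1 - x) ^ 2
          + 2 * (Real.negMulLog x * Real.negMulLog (1 - x))) ∂betaMeasure a a := by
        congr with x
        rw [Real.binEntropy_eq_negMulLog_add_negMulLog_one_sub]
        ring
    _ = 2 * ∫ x, Real.negMulLog x ^ 2 ∂betaMeasure a a
        + 2 * ∫ x, Real.negMulLog x * Real.negMulLog (1 - x) ∂betaMeasure a a := by
        rw [integral_add (integrable (by fun_prop)) (integrable (by fun_prop)),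
          integral_add (integrable (by fun_prop)) (integrable (by fun_prop)),
          integral_one_sub_betaMeasure ha ha fun x => Real.negMulLog x ^ 2, integral_const_mul,
          two_mul (∫ x, Real.negMulLog x ^ 2 ∂betaMeasure a a)]
    _ = _ := by
        rw [integral_negMulLog_sq_betaMeasure ha ha,
          integral_negMulLog_mul_negMulLog_one_sub_betaMeasure ha ha, ← two_mul a]
        field_simp

end SymmetricBetaDistribution

section RandomConvexCombination

variable {Ω : Type*} {𝒜 ℬ mΩ : MeasurableSpace Ω} {P : Measure Ω}

lemma indepFun_of_indep {E E' : Type*} [MeasurableSpace E] [MeasurableSpace E']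
    (h : Indep 𝒜 ℬ P) {X : Ω → E} {Z : Ω → E'} (hX : Measurable[𝒜] X) (hZ : Measurable[ℬ] Z) :
    IndepFun X Z P :=
  (IndepFun_iff_Indep _ _ _).2
    (indep_of_indep_of_le_left (indep_of_indep_of_le_right h hZ.comap_le) hX.comap_le)

variable {ι : Type*} {s : Finset ι} {W ξ : ι → Ω → ℝ} {c v : ℝ}

lemma integral_mul_convexCombination (h : Indep 𝒜 ℬ P) {Z : Ω → ℝ} (hZ : Measurable[𝒜] Z)
    (hW : ∀ i ∈ s, Measurable[𝒜] (W i)) (hξ : ∀ i ∈ s, Measurable[ℬ] (ξ i))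
    (integrable_mul : ∀ i ∈ s, Integrable (fun ω => Z ω * W i ω) P)
    (integrable_ξ : ∀ i ∈ s, Integrable (ξ i) P) (sum_W : ∀ ω, ∑ i ∈ s, W i ω = 1)
    (mean : ∀ i ∈ s, ∫ ω, ξ i ω ∂P = c) :
    ∫ ω, Z ω * ∑ i ∈ s, W i ω * ξ i ω ∂P = c * ∫ ω, Z ω ∂P := by
  have indep (i) (hi : i ∈ s) : IndepFun (fun ω => Z ω * W i ω) (ξ i) P :=
    indepFun_of_indep h (hZ.mul (hW i hi)) (hξ i hi)
  calc ∫ ω, Z ω * ∑ i ∈ s, W i ω * ξ i ω ∂P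
      = ∫ ω, ∑ i ∈ s, Z ω * W i ω * ξ i ω ∂P := by simp only [Finset.mul_sum, mul_assoc]
    _ = ∑ i ∈ s, ∫ ω, Z ω * W i ω * ξ i ω ∂P := integral_finsetSum s fun i hi =>
        (indep i hi).integrable_mul (integrable_mul i hi) (integrable_ξ i hi)
    _ = ∑ i ∈ s, c * ∫ ω, Z ω * W i ω ∂P := Finset.sum_congr rfl fun i hi => by
        rw [(indep i hi).integral_fun_mul_eq_mul_integral (integrable_mul i hi).aestronglyMeasurable
          (integrable_ξ i hi).aestronglyMeasurable, mean i hi, mul_comm]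
    _ = c * ∫ ω, ∑ i ∈ s, Z ω * W i ω ∂P := by
        rw [integral_finsetSum s integrable_mul, Finset.mul_sum]
    _ = c * ∫ ω, Z ω ∂P := by simp only [← Finset.mul_sum, sum_W, mul_one]

lemma integral_sq_sum_mul_of_indep (h : Indep 𝒜 ℬ P)
    (hW : ∀ i ∈ s, Measurable[𝒜] (W i)) (hξ : ∀ i ∈ s, Measurable[ℬ] (ξ i))
    (memLp_W : ∀ i ∈ s, MemLp (W i) 2 P) (memLp_ξ : ∀ i ∈ s, MemLp (ξ i) 2 P) :
    ∫ ω, (∑ i ∈ s, W i ω * ξ i ω) ^ 2 ∂P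
      = ∑ i ∈ s, ∑ j ∈ s, (∫ ω, W i ω * W j ω ∂P) * ∫ ω, ξ i ω * ξ j ω ∂P := by
  have indep (i) (hi : i ∈ s) (j) (hj : j ∈ s) :
      IndepFun (fun ω => W i ω * W j ω) (fun ω => ξ i ω * ξ j ω) P :=
    indepFun_of_indep h ((hW i hi).mul (hW j hj)) ((hξ i hi).mul (hξ j hj))
  have integrable_W (i) (hi : i ∈ s) (j) (hj : j ∈ s) :
      Integrable (fun ω => W i ω * W j ω) P := (memLp_W i hi).integrable_mul (memLp_W j hj)
  have integrable_ξ (i) (hi : i ∈ s) (j) (hj : j ∈ s) :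
      Integrable (fun ω => ξ i ω * ξ j ω) P := (memLp_ξ i hi).integrable_mul (memLp_ξ j hj)
  have integrable_mul (i) (hi : i ∈ s) (j) (hj : j ∈ s) :
      Integrable (fun ω => W i ω * W j ω * (ξ i ω * ξ j ω)) P :=
    (indep i hi j hj).integrable_mul (integrable_W i hi j hj) (integrable_ξ i hi j hj)
  simp only [sq, Finset.sum_mul_sum, mul_mul_mul_comm]
  rw [integral_finsetSum s fun i hi => integrable_finsetSum s (integrable_mul i hi)]
  refine Finset.sum_congr rfl fun i hi => ?_
  rw [integral_finsetSum s (integrable_mul i hi)]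
  exact Finset.sum_congr rfl fun j hj => (indep i hi j hj).integral_fun_mul_eq_mul_integral
    (integrable_W i hi j hj).aestronglyMeasurable (integrable_ξ i hi j hj).aestronglyMeasurable

lemma variance_convexCombination [IsProbabilityMeasure P] (h : Indep 𝒜 ℬ P)
    (hW : ∀ i ∈ s, Measurable[𝒜] (W i)) (hξ : ∀ i ∈ s, Measurable[ℬ] (ξ i))
    (memLp_W : ∀ i ∈ s, MemLp (W i) 2 P) (memLp_ξ : ∀ i ∈ s, MemLp (ξ i) 2 P)
    (sum_W : ∀ ω, ∑ i ∈ s, W i ω = 1) (mean : ∀ i ∈ s, ∫ ω, ξ i ω ∂P = c)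
    (variance_ξ : ∀ i ∈ s, Var[ξ i; P] = v)
    (uncorrelated : (s : Set ι).Pairwise fun i j => cov[ξ i, ξ j; P] = 0) :
    Var[fun ω => ∑ i ∈ s, W i ω * ξ i ω; P] = v * ∑ i ∈ s, ∫ ω, W i ω ^ 2 ∂P := by
  have integrable_W (i) (hi : i ∈ s) : Integrable (W i) P := (memLp_W i hi).integrable one_le_two
  have integrable_ξ (i) (hi : i ∈ s) : Integrable (ξ i) P := (memLp_ξ i hi).integrable one_le_two
  have integral_eq : ∫ ω, ∑ i ∈ s, W i ω * ξ i ω ∂P = c := by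
    simpa using integral_mul_convexCombination h (Z := fun _ => 1) measurable_const hW hξ
      (by simpa using integrable_W) integrable_ξ sum_W mean
  have aemeasurable : AEMeasurable (fun ω => ∑ i ∈ s, W i ω * ξ i ω) P :=
    Finset.aemeasurable_fun_sum s fun i hi =>
      (integrable_W i hi).aemeasurable.mul (integrable_ξ i hi).aemeasurable
  have centred_eq (ω) : ∑ i ∈ s, W i ω * ξ i ω - c = ∑ i ∈ s, W i ω * (ξ i ω - c) := by
    simp only [mul_sub, Finset.sum_sub_distrib, ← Finset.sum_mul, sum_W, one_mul]
  have integral_centred_mul (i) (hi : i ∈ s) (j) (hj : j ∈ s) :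
      ∫ ω, (ξ i ω - c) * (ξ j ω - c) ∂P = cov[ξ i, ξ j; P] := by
    rw [covariance, mean i hi, mean j hj]
  rw [variance_eq_integral aemeasurable, integral_eq]
  simp only [centred_eq]
  rw [integral_sq_sum_mul_of_indep h hW (fun i hi => (hξ i hi).sub_const c) memLp_W
    fun i hi => (memLp_ξ i hi).sub (memLp_const c), Finset.mul_sum]
  refine Finset.sum_congr rfl fun i hi => ?_
  rw [Finset.sum_eq_single_of_mem i hi fun j hj hji => by
      rw [integral_centred_mul i hi j hj, uncorrelated hi hj hji.symm, mul_zero],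
    integral_centred_mul i hi i hi, covariance_self (integrable_ξ i hi).aemeasurable,
    variance_ξ i hi, mul_comm]
  simp only [sq]

end RandomConvexCombination

section BranchingProbabilities

/-- The mass `∏_{l=1}^m y_{l, j_l^{(m,j)}}` that a tree with branching probabilities `y` gives
to the set `B_{mj}`. -/
noncomputable def nodeMass (y : ℕ → ℕ → ℝ) (m j : ℕ) : ℝ :=
  ∏ l ∈ Finset.Icc 1 m, y l (ancestor m j l)

/-- The branching probabilities of siblings at the levels `1, …, M` add up to one. The siblings
`2 * i + 1` and `2 * i + 2` at level `m + 1` are the children of the node `i + 1` at level `m`. -/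
def IsBranching (M : ℕ) (y : ℕ → ℕ → ℝ) : Prop :=
  ∀ m < M, ∀ i < 2 ^ m, y (m + 1) (2 * i + 2) = 1 - y (m + 1) (2 * i + 1)

/-- The conditional entropy of the level `m + 1` of the tree, given its level `m`. -/
noncomputable def levelEntropy (y : ℕ → ℕ → ℝ) (m : ℕ) : ℝ :=
  ∑ i ∈ Finset.range (2 ^ m), nodeMass y m (i + 1) * Real.binEntropy (y (m + 1) (2 * i + 1))

lemma ancestor_self (m j : ℕ) : ancestor m j m = j := by
  rw [ancestor, Nat.sub_self, Function.iterate_zero_apply]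

lemma ancestor_succ {m l : ℕ} (h : l ≤ m) (j : ℕ) :
    ancestor (m + 1) j l = ancestor m ((j + 1) / 2) l := by
  rw [ancestor, ancestor, Nat.succ_sub h, Function.iterate_succ_apply]

lemma nodeMass_zero (y : ℕ → ℕ → ℝ) (j : ℕ) : nodeMass y 0 j = 1 := Finset.prod_empty

lemma nodeMass_succ (y : ℕ → ℕ → ℝ) (m j : ℕ) :
    nodeMass y (m + 1) j = nodeMass y m ((j + 1) / 2) * y (m + 1) j := by
  rw [nodeMass, Finset.prod_Icc_succ_top (by lia), ancestor_self, nodeMass]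
  congr 1
  exact Finset.prod_congr rfl fun l hl => by rw [ancestor_succ (Finset.mem_Icc.1 hl).2]

lemma nodeMass_succ_left (y : ℕ → ℕ → ℝ) (m i : ℕ) :
    nodeMass y (m + 1) (2 * i + 1) = nodeMass y m (i + 1) * y (m + 1) (2 * i + 1) := by
  rw [nodeMass_succ, show (2 * i + 1 + 1) / 2 = i + 1 by lia]

lemma nodeMass_succ_right (y : ℕ → ℕ → ℝ) (m i : ℕ) :
    nodeMass y (m + 1) (2 * i + 2) = nodeMass y m (i + 1) * y (m + 1) (2 * i + 2) := by
  rw [nodeMass_succ, show (2 * i + 2 + 1) / 2 = i + 1 by lia]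

lemma forall_lt_two_pow_succ {m : ℕ} {p : ℕ → Prop} :
    (∀ i < 2 ^ (m + 1), p i) ↔ ∀ i < 2 ^ m, p (2 * i) ∧ p (2 * i + 1) := by
  rw [pow_succ']
  refine ⟨fun h i hi => ⟨h _ (by lia), h _ (by lia)⟩, fun h i hi => ?_⟩
  obtain ⟨k, rfl | rfl⟩ := Nat.even_or_odd' i
  · exact (h k (by lia)).1
  · exact (h k (by lia)).2

lemma sum_range_two_pow_succ {N : Type*} [AddCommMonoid N] (m : ℕ) (g : ℕ → N) :
    ∑ j ∈ Finset.range (2 ^ (m + 1)), g j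
      = ∑ i ∈ Finset.range (2 ^ m), (g (2 * i) + g (2 * i + 1)) := by
  rw [pow_succ']
  induction 2 ^ m with
  | zero => simp
  | succ n ih => rw [Finset.sum_range_succ, ← ih, Nat.mul_succ, Finset.sum_range_succ,
      Finset.sum_range_succ, add_assoc]

lemma sum_Icc_one_eq_sum_range {N : Type*} [AddCommMonoid N] (n : ℕ) (g : ℕ → N) :
    ∑ j ∈ Finset.Icc 1 n, g j = ∑ i ∈ Finset.range n, g (i + 1) := by
  rw [Finset.range_eq_Ico, Finset.sum_Ico_add' g 0 n 1]
  rfl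

lemma prod_ancestor_eq_nodeMass (y : ℕ → ℕ → ℝ) (m j : ℕ) :
    ∏ k ∈ Finset.Icc 1 m, y (m - k + 1) (ancestor m j (m - k + 1)) = nodeMass y m j := by
  refine Finset.prod_nbij' (fun k => m - k + 1) (fun k => m - k + 1) ?_ ?_ ?_ ?_ fun _ _ => rfl
  all_goals
    intro k hk
    simp only [Finset.mem_Icc] at hk ⊢
    lia

variable {M : ℕ} {y : ℕ → ℕ → ℝ}

namespace IsBranching

lemma mono {M' : ℕ} (hy : IsBranching M' y) (hM : M ≤ M') : IsBranching M y :=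
  fun m hm i hi => hy m (hm.trans_le hM) i hi

lemma sum_nodeMass (hy : IsBranching M y) :
    ∑ i ∈ Finset.range (2 ^ M), nodeMass y M (i + 1) = 1 := by
  induction M with
  | zero => simp [nodeMass_zero]
  | succ m ih =>
    rw [sum_range_two_pow_succ, ← ih (hy.mono m.le_succ)]
    refine Finset.sum_congr rfl fun i hi => ?_
    rw [nodeMass_succ_left, nodeMass_succ_right, hy m m.lt_succ_self i (Finset.mem_range.1 hi)]
    ring

lemma nodeMass_nonneg (hy : IsBranching M y)
    (mem_Icc : ∀ m < M, ∀ i < 2 ^ m, y (m + 1) (2 * i + 1) ∈ Icc (0 : ℝ) 1) :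
    ∀ i < 2 ^ M, 0 ≤ nodeMass y M (i + 1) := by
  induction M with
  | zero => exact fun i _ => (nodeMass_zero y _).ge.trans' zero_le_one
  | succ m ih =>
    rw [forall_lt_two_pow_succ]
    intro i hi
    have parent_nonneg :=
      ih (hy.mono m.le_succ) (fun l hl => mem_Icc l (hl.trans m.lt_succ_self)) i hi
    have left_mem := mem_Icc m m.lt_succ_self i hi
    rw [nodeMass_succ_left, nodeMass_succ_right, hy m m.lt_succ_self i hi]
    exact ⟨mul_nonneg parent_nonneg left_mem.1, mul_nonneg parent_nonneg (sub_nonneg.2 left_mem.2)⟩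

lemma sum_negMulLog_nodeMass (hy : IsBranching M y) :
    ∑ i ∈ Finset.range (2 ^ M), Real.negMulLog (nodeMass y M (i + 1))
      = ∑ m ∈ Finset.range M, levelEntropy y m := by
  induction M with
  | zero => simp [nodeMass_zero]
  | succ m ih =>
    rw [Finset.sum_range_succ, ← ih (hy.mono m.le_succ), levelEntropy, sum_range_two_pow_succ,
      ← Finset.sum_add_distrib]
    refine Finset.sum_congr rfl fun i hi => ?_
    rw [nodeMass_succ_left, nodeMass_succ_right, hy m m.lt_succ_self i (Finset.mem_range.1 hi),
      Real.negMulLog_mul, Real.negMulLog_mul, Real.binEntropy_eq_negMulLog_add_negMulLog_one_sub]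
    ring

lemma sum_log_mul_nodeMass {m : ℕ} (hy : IsBranching M y) (hm : m < M) :
    ∑ j ∈ Finset.Icc 1 (2 ^ (m + 1)), Real.log (y (m + 1) j) * nodeMass y (m + 1) j
      = -levelEntropy y m := by
  rw [sum_Icc_one_eq_sum_range, sum_range_two_pow_succ, levelEntropy, ← Finset.sum_neg_distrib]
  refine Finset.sum_congr rfl fun i hi => ?_
  rw [nodeMass_succ_left, nodeMass_succ_right, hy m hm i (Finset.mem_range.1 hi),
    Real.binEntropy_eq_negMulLog_add_negMulLog_one_sub, Real.negMulLog, Real.negMulLog]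
  ring

lemma reverseKLSum_eq (hy : IsBranching M y) :
    reverseKLSum M y = M * Real.log 2 - ∑ m ∈ Finset.range M, levelEntropy y m := by
  simp only [reverseKLSum, prod_ancestor_eq_nodeMass]
  rw [sum_Icc_one_eq_sum_range, Finset.sum_congr rfl fun m hm =>
    hy.sum_log_mul_nodeMass (Finset.mem_range.1 hm), Finset.sum_neg_distrib, neg_add_eq_sub]

end IsBranching

end BranchingProbabilities

section QuantileCells

variable (F₀ : Measure ℝ)

lemma nonempty_le_cdf {u : ℝ} (hu : u < 1) : {x | u ≤ cdf F₀ x}.Nonempty :=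
  ((tendsto_cdf_atTop F₀).eventually (lt_mem_nhds hu)).exists.imp fun _ hx => hx.le

lemma bddBelow_le_cdf {u : ℝ} (hu : 0 < u) : BddBelow {x | u ≤ cdf F₀ x} := by
  obtain ⟨b, cdf_lt⟩ := ((tendsto_cdf_atBot F₀).eventually (gt_mem_nhds hu)).exists
  exact ⟨b, fun x hx => le_of_not_gt fun hxb =>
    (cdf_lt.trans_le hx).not_ge (monotone_cdf F₀ hxb.le)⟩

lemma quantile_of_nonpos {u : ℝ} (hu : u ≤ 0) : quantile F₀ u = ⊥ := if_pos hu

lemma quantile_of_one_le {u : ℝ} (hu : 1 ≤ u) : quantile F₀ u = ⊤ := by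
  rw [quantile, if_neg (zero_lt_one.trans_le hu).not_ge, if_pos hu]

lemma quantile_of_mem_Ioo {u : ℝ} (hu : u ∈ Ioo (0 : ℝ) 1) :
    quantile F₀ u = ((sInf {x | u ≤ cdf F₀ x} : ℝ) : EReal) := by
  rw [quantile, if_neg hu.1.not_ge, if_neg hu.2.not_ge]

lemma quantile_mono : Monotone (quantile F₀) := by
  intro u v huv
  rcases le_or_gt u 0 with hu | hu
  · exact (quantile_of_nonpos F₀ hu).trans_le bot_le
  rcases le_or_gt 1 v with hv | hv
  · exact le_top.trans_eq (quantile_of_one_le F₀ hv).symm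
  rw [quantile_of_mem_Ioo F₀ ⟨hu, huv.trans_lt hv⟩, quantile_of_mem_Ioo F₀ ⟨hu.trans_le huv, hv⟩,
    EReal.coe_le_coe_iff]
  exact csInf_le_csInf (bddBelow_le_cdf F₀ hu) (nonempty_le_cdf F₀ hv) fun _ hx => huv.trans hx

lemma measurableSet_le_quantile (u : ℝ) : MeasurableSet {x : ℝ | (x : EReal) ≤ quantile F₀ u} :=
  measurableSet_le measurable_coe_real_ereal measurable_const

lemma cell_eq_sdiff (m j : ℕ) :
    cell F₀ m j = {x : ℝ | (x : EReal) ≤ quantile F₀ ((j : ℝ) / 2 ^ m)} \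
      {x : ℝ | (x : EReal) ≤ quantile F₀ (((j : ℝ) - 1) / 2 ^ m)} := by
  ext x
  simp only [cell, mem_ofPred_eq, Set.mem_sdiff, not_le, and_comm]

lemma measurableSet_cell (m j : ℕ) : MeasurableSet (cell F₀ m j) :=
  cell_eq_sdiff F₀ m j ▸
    MeasurableSet.diff (measurableSet_le_quantile F₀ _) (measurableSet_le_quantile F₀ _)

lemma exists_mem_cell (m : ℕ) (x : ℝ) : ∃ j, 1 ≤ j ∧ j ≤ 2 ^ m ∧ x ∈ cell F₀ m j := by
  classical
  have le_quantile_top : (x : EReal) ≤ quantile F₀ (((2 ^ m : ℕ) : ℝ) / 2 ^ m) := by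
    rw [quantile_of_one_le F₀ (by simp)]
    exact le_top
  have exists_le : ∃ j : ℕ, (x : EReal) ≤ quantile F₀ ((j : ℝ) / 2 ^ m) := ⟨_, le_quantile_top⟩
  have find_ne_zero : Nat.find exists_le ≠ 0 := fun h => by
    have le_bot := Nat.find_spec exists_le
    rw [h, quantile_of_nonpos F₀ (by simp)] at le_bot
    exact EReal.coe_ne_bot x (le_bot_iff.1 le_bot)
  obtain ⟨k, hk⟩ := Nat.exists_eq_succ_of_ne_zero find_ne_zero
  have lt_x := not_le.1 (Nat.find_min exists_le (m := k) (hk ▸ k.lt_succ_self))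
  refine ⟨Nat.find exists_le, Nat.one_le_iff_ne_zero.2 find_ne_zero,
    Nat.find_min' exists_le le_quantile_top, ?_, Nat.find_spec exists_le⟩
  rwa [hk, Nat.cast_succ, add_sub_cancel_right]

lemma cell_unique {m j k : ℕ} {x : ℝ} (hj : x ∈ cell F₀ m j) (hk : x ∈ cell F₀ m k) : j = k := by
  by_contra hne
  wlog hjk : j < k generalizing j k
  · exact this hk hj (Ne.symm hne) (by lia)
  have endpoints_le : (j : ℝ) / 2 ^ m ≤ ((k : ℝ) - 1) / 2 ^ m := by
    have : (j : ℝ) + 1 ≤ k := mod_cast hjk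
    gcongr
    linarith
  exact (hj.2.trans (quantile_mono F₀ endpoints_le)).not_gt hk.1

lemma one_le_cellIndex (m : ℕ) (x : ℝ) : 1 ≤ cellIndex F₀ m x :=
  (Nat.sInf_mem (exists_mem_cell F₀ m x)).1

lemma cellIndex_le (m : ℕ) (x : ℝ) : cellIndex F₀ m x ≤ 2 ^ m :=
  (Nat.sInf_mem (exists_mem_cell F₀ m x)).2.1

lemma mem_cell_cellIndex (m : ℕ) (x : ℝ) : x ∈ cell F₀ m (cellIndex F₀ m x) :=
  (Nat.sInf_mem (exists_mem_cell F₀ m x)).2.2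

lemma cellIndex_eq_iff {m j : ℕ} {x : ℝ} : cellIndex F₀ m x = j ↔ x ∈ cell F₀ m j :=
  ⟨fun h => h ▸ mem_cell_cellIndex F₀ m x, cell_unique F₀ (mem_cell_cellIndex F₀ m x)⟩

lemma cell_succ_subset (m j : ℕ) : cell F₀ (m + 1) j ⊆ cell F₀ m ((j + 1) / 2) := by
  rintro x ⟨left_lt, le_right⟩
  have lower : 2 * (((j + 1) / 2 : ℕ) : ℝ) ≤ j + 1 := mod_cast (by lia : 2 * ((j + 1) / 2) ≤ j + 1)
  have upper : (j : ℝ) ≤ 2 * (((j + 1) / 2 : ℕ) : ℝ) := mod_cast (by lia : j ≤ 2 * ((j + 1) / 2))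
  have div_two_pow_succ (a : ℝ) : a / 2 ^ (m + 1) = a / 2 / 2 ^ m := by rw [pow_succ', div_div]
  refine ⟨(quantile_mono F₀ ?_).trans_lt left_lt, le_right.trans (quantile_mono F₀ ?_)⟩ <;>
  · rw [div_two_pow_succ]
    gcongr
    linarith

lemma cellIndex_succ (m : ℕ) (x : ℝ) : (cellIndex F₀ (m + 1) x + 1) / 2 = cellIndex F₀ m x :=
  ((cellIndex_eq_iff F₀).2 (cell_succ_subset F₀ m _ (mem_cell_cellIndex F₀ (m + 1) x))).symm

lemma ancestor_cellIndex {m M : ℕ} (h : m ≤ M) (x : ℝ) :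
    ancestor M (cellIndex F₀ M x) m = cellIndex F₀ m x := by
  induction M, h using Nat.le_induction with
  | base => exact ancestor_self _ _
  | succ M hM ih => rw [ancestor_succ hM, cellIndex_succ, ih]

lemma measurable_cellIndex (m : ℕ) : Measurable (cellIndex F₀ m) :=
  measurable_to_countable' fun j => by
    rw [show cellIndex F₀ m ⁻¹' {j} = cell F₀ m j from Set.ext fun _ => cellIndex_eq_iff F₀]
    exact measurableSet_cell F₀ m j

lemma comp_cellIndex_eq_sum_indicator (M : ℕ) (g : ℕ → ℝ) (x : ℝ) :
    g (cellIndex F₀ M x)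
      = ∑ j ∈ Finset.Icc 1 (2 ^ M), (cell F₀ M j).indicator (fun _ => g j) x := by
  rw [Finset.sum_eq_single_of_mem (cellIndex F₀ M x)
      (Finset.mem_Icc.2 ⟨one_le_cellIndex F₀ M x, cellIndex_le F₀ M x⟩),
    indicator_of_mem (mem_cell_cellIndex F₀ M x)]
  exact fun j _ hne => indicator_of_notMem (fun h => hne ((cellIndex_eq_iff F₀).2 h).symm) _

lemma integrable_comp_cellIndex [IsFiniteMeasure F₀] (M : ℕ) (g : ℕ → ℝ) :
    Integrable (fun x => g (cellIndex F₀ M x)) F₀ := by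
  simp only [comp_cellIndex_eq_sum_indicator]
  exact integrable_finsetSum _ fun j _ =>
    (integrable_const _).indicator (measurableSet_cell F₀ M j)

variable [IsProbabilityMeasure F₀] [NullSingletonClass F₀]

lemma continuous_cdf : Continuous (cdf F₀) := by
  refine continuous_iff_continuousAt.2 fun x => ?_
  have singleton_null : ENNReal.ofReal (cdf F₀ x - Function.leftLim (cdf F₀) x) = 0 := by
    rw [← StieltjesFunction.measure_singleton, measure_cdf, measure_singleton]
  have leftLim_eq : Function.leftLim (cdf F₀) x = cdf F₀ x :=
    ((cdf F₀).mono.leftLim_le le_rfl).antisymm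
      (sub_nonpos.1 (ENNReal.ofReal_eq_zero.1 singleton_null))
  exact (cdf F₀).mono.continuousAt_iff_leftLim_eq_rightLim.2
    (leftLim_eq.trans ((cdf F₀).rightLim_eq x).symm)

lemma cdf_sInf_le_cdf {u : ℝ} (hu : u ∈ Ioo (0 : ℝ) 1) : cdf F₀ (sInf {x | u ≤ cdf F₀ x}) = u := by
  have bddBelow := bddBelow_le_cdf F₀ hu.1
  have le_cdf_sInf : u ≤ cdf F₀ (sInf {x | u ≤ cdf F₀ x}) :=
    (isClosed_le continuous_const (continuous_cdf F₀)).csInf_mem (nonempty_le_cdf F₀ hu.2) bddBelow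
  obtain ⟨x, rfl⟩ : u ∈ range (cdf F₀) :=
    mem_range_of_exists_le_of_exists_ge (continuous_cdf F₀)
      ((tendsto_cdf_atBot F₀).eventually (ge_mem_nhds hu.1)).exists
      ((tendsto_cdf_atTop F₀).eventually (le_mem_nhds hu.2)).exists
  exact (monotone_cdf F₀ (csInf_le bddBelow (le_refl (cdf F₀ x)))).antisymm le_cdf_sInf

lemma measureReal_le_quantile {u : ℝ} (hu : u ∈ Icc (0 : ℝ) 1) :
    F₀.real {x : ℝ | (x : EReal) ≤ quantile F₀ u} = u := by
  rcases hu.1.eq_or_lt with rfl | hu₀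
  · simp [quantile_of_nonpos]
  rcases hu.2.eq_or_lt with rfl | hu₁
  · simp [quantile_of_one_le]
  simp only [quantile_of_mem_Ioo F₀ ⟨hu₀, hu₁⟩, EReal.coe_le_coe_iff]
  exact (cdf_eq_real F₀ _).symm.trans (cdf_sInf_le_cdf F₀ ⟨hu₀, hu₁⟩)

lemma measureReal_cell {m j : ℕ} (hj : 1 ≤ j) (hj' : j ≤ 2 ^ m) :
    F₀.real (cell F₀ m j) = 1 / 2 ^ m := by
  have one_le : (1 : ℝ) ≤ j := mod_cast hj
  have le_two_pow : (j : ℝ) ≤ 2 ^ m := mod_cast hj'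
  have two_pow_pos : (0 : ℝ) < 2 ^ m := by positivity
  have left_le_right : ((j : ℝ) - 1) / 2 ^ m ≤ j / 2 ^ m := by gcongr; linarith
  have right_le_one : (j : ℝ) / 2 ^ m ≤ 1 := (div_le_one two_pow_pos).2 le_two_pow
  have left_nonneg : 0 ≤ ((j : ℝ) - 1) / 2 ^ m := div_nonneg (by linarith) two_pow_pos.le
  rw [cell_eq_sdiff, measureReal_sdiff
      (ofPred_subset_ofPred.2 fun x hx => hx.trans (quantile_mono F₀ left_le_right))
      (measurableSet_le_quantile F₀ _),
    measureReal_le_quantile F₀ ⟨left_nonneg.trans left_le_right, right_le_one⟩,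
    measureReal_le_quantile F₀ ⟨left_nonneg, left_le_right.trans right_le_one⟩]
  ring

lemma integral_comp_cellIndex (M : ℕ) (g : ℕ → ℝ) :
    ∫ x, g (cellIndex F₀ M x) ∂F₀ = (∑ i ∈ Finset.range (2 ^ M), g (i + 1)) / 2 ^ M := by
  have integral_cell (j : ℕ) (hj : j ∈ Finset.Icc 1 (2 ^ M)) :
      ∫ x, (cell F₀ M j).indicator (fun _ => g j) x ∂F₀ = g j / 2 ^ M := by
    obtain ⟨one_le, le_two_pow⟩ := Finset.mem_Icc.1 hj
    rw [integral_indicator_const _ (measurableSet_cell F₀ M j),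
      measureReal_cell F₀ one_le le_two_pow, smul_eq_mul]
    ring
  simp only [comp_cellIndex_eq_sum_indicator]
  rw [integral_finsetSum _ fun j _ => (integrable_const _).indicator (measurableSet_cell F₀ M j),
    Finset.sum_congr rfl integral_cell, sum_Icc_one_eq_sum_range, Finset.sum_div]

end QuantileCells

section KullbackLeibler

namespace IsDensity

variable {f g : ℝ → ℝ} {μ : Measure ℝ}

lemma nullSingletonClass (hf : IsDensity f μ) : NullSingletonClass μ := by
  rw [hf.eq_withDensity]
  infer_instance

lemma ae_eq (hf : IsDensity f μ) (hg : IsDensity g μ) : f =ᵐ[volume] g := by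
  have ofReal_ae_eq := hf.eq_withDensity.symm.trans hg.eq_withDensity
  rw [withDensity_eq_iff_of_sigmaFinite hf.measurable.ennreal_ofReal.aemeasurable
    hg.measurable.ennreal_ofReal.aemeasurable] at ofReal_ae_eq
  filter_upwards [ofReal_ae_eq] with x hx
  rwa [ENNReal.ofReal_eq_ofReal_iff (hf.nonneg x) (hg.nonneg x)] at hx

lemma integrable_mul_iff (hf : IsDensity f μ) (φ : ℝ → ℝ) :
    Integrable (fun x => f x * φ x) ↔ Integrable φ μ := by
  rw [hf.eq_withDensity, integrable_withDensity_iff_integrable_smul' hf.measurable.ennreal_ofReal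
    (Eventually.of_forall fun _ => ENNReal.ofReal_lt_top)]
  simp only [ENNReal.toReal_ofReal (hf.nonneg _), smul_eq_mul]

lemma integral_mul (hf : IsDensity f μ) (φ : ℝ → ℝ) : ∫ x, f x * φ x = ∫ x, φ x ∂μ := by
  rw [hf.eq_withDensity, integral_withDensity_eq_integral_toReal_smul hf.measurable.ennreal_ofReal
    (Eventually.of_forall fun _ => ENNReal.ofReal_lt_top)]
  simp only [ENNReal.toReal_ofReal (hf.nonneg _), smul_eq_mul]

end IsDensity

variable {M : ℕ} {F₀ : Measure ℝ} {f₀ : ℝ → ℝ} {y : ℕ → ℕ → ℝ}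

lemma treeDensity_eq (x : ℝ) :
    treeDensity M F₀ f₀ y x = nodeMass y M (cellIndex F₀ M x) * 2 ^ M * f₀ x := by
  rw [treeDensity, nodeMass]
  congr 2
  exact Finset.prod_congr rfl fun m hm => by
    rw [ancestor_cellIndex F₀ (Finset.mem_Icc.1 hm).2]

lemma isDensity_treeDensity (hf₀ : IsDensity f₀ F₀) (hy : IsBranching M y)
    (mem_Icc : ∀ m < M, ∀ i < 2 ^ m, y (m + 1) (2 * i + 1) ∈ Icc (0 : ℝ) 1) :
    IsDensity (treeDensity M F₀ f₀ y)
      (volume.withDensity fun x => ENNReal.ofReal (treeDensity M F₀ f₀ y x)) where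
  measurable := by
    have measurable_leafMass : Measurable fun x => nodeMass y M (cellIndex F₀ M x) :=
      (measurable_from_nat (f := nodeMass y M)).comp (measurable_cellIndex F₀ M)
    rw [funext treeDensity_eq]
    exact (measurable_leafMass.mul_const (2 ^ M)).mul hf₀.measurable
  nonneg x := by
    obtain ⟨i, hi⟩ := Nat.exists_eq_add_of_le' (one_le_cellIndex F₀ M x)
    have i_lt : i < 2 ^ M := by have := cellIndex_le F₀ M x; lia
    rw [treeDensity_eq, hi]
    exact mul_nonneg (mul_nonneg (hy.nodeMass_nonneg mem_Icc i i_lt) (by positivity)) (hf₀.nonneg x)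
  eq_withDensity := rfl

lemma klIntegrand_treeDensity :
    klIntegrand (treeDensity M F₀ f₀ y) f₀
      = fun x => f₀ x * -Real.negMulLog (nodeMass y M (cellIndex F₀ M x) * 2 ^ M) := by
  ext x
  rw [klIntegrand, treeDensity_eq, Real.negMulLog]
  rcases eq_or_ne (f₀ x) 0 with hx | hx
  · rw [hx, mul_zero, mul_zero, zero_mul]
  · rw [mul_div_cancel_right₀ _ hx]
    ring

lemma IsBranching.sum_negMulLog_nodeMass_mul_two_pow (hy : IsBranching M y) :
    (∑ i ∈ Finset.range (2 ^ M), -Real.negMulLog (nodeMass y M (i + 1) * 2 ^ M)) / 2 ^ M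
      = reverseKLSum M y := by
  simp only [Real.negMulLog_mul, Finset.sum_neg_distrib, Finset.sum_add_distrib,
    ← Finset.mul_sum, ← Finset.sum_mul]
  rw [hy.sum_nodeMass, hy.sum_negMulLog_nodeMass, hy.reverseKLSum_eq, Real.negMulLog, Real.log_pow]
  field

lemma integrable_klIntegrand_treeDensity [IsFiniteMeasure F₀] (hf₀ : IsDensity f₀ F₀) :
    Integrable (klIntegrand (treeDensity M F₀ f₀ y) f₀) := by
  rw [klIntegrand_treeDensity, hf₀.integrable_mul_iff]
  exact integrable_comp_cellIndex F₀ M fun j => -Real.negMulLog (nodeMass y M j * 2 ^ M)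

lemma kl_treeDensity [IsProbabilityMeasure F₀] (hf₀ : IsDensity f₀ F₀) (hy : IsBranching M y) :
    kl (treeDensity M F₀ f₀ y) f₀ = reverseKLSum M y := by
  have := hf₀.nullSingletonClass
  rw [kl, klIntegrand_treeDensity, hf₀.integral_mul,
    integral_comp_cellIndex F₀ M fun j => -Real.negMulLog (nodeMass y M j * 2 ^ M),
    hy.sum_negMulLog_nodeMass_mul_two_pow]

end KullbackLeibler

section ClosedForm

variable {α : ℝ} {ρ : ℕ → ℝ}

lemma ratioProd_zero : ratioProd α ρ 0 = 1 := Finset.prod_empty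

lemma ratioProd_succ (m : ℕ) : ratioProd α ρ (m + 1)
    = ratioProd α ρ m * ((α * ρ (m + 1) + 1) / (2 * α * ρ (m + 1) + 1)) :=
  Finset.prod_Icc_succ_top (by lia) _

lemma lambda3_add_lambda4 {m : ℕ} (hm : 0 < α * ρ m) :
    (α * ρ m + 1) / (2 * α * ρ m + 1) * lambda3 α ρ m
      + α * ρ m / (2 * α * ρ m + 1) * lambda4 α ρ m = lambda2 α ρ m := by
  have two_mul_add_one_pos : 0 < 2 * α * ρ m + 1 := by linarith
  rw [lambda2, lambda3, lambda4, show α * ρ m + 2 = α * ρ m + 1 + 1 by ring,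
    show 2 * α * ρ m + 2 = 2 * α * ρ m + 1 + 1 by ring, digamma_add_one (by linarith),
    digamma_add_one two_mul_add_one_pos]
  field

lemma sum_ratioProd_sub_half_pow {n : ℕ} (hp : ∀ m, 1 ≤ m → m ≤ n → 0 < α * ρ m) :
    ∑ j ∈ Finset.Icc 1 n, (α * ρ j / (2 * α * ρ j + 1) * ratioProd α ρ (j - 1) - (1 / 2 : ℝ) ^ j)
      = (1 / 2 : ℝ) ^ n - ratioProd α ρ n := by
  induction n with
  | zero => simp [ratioProd_zero]
  | succ n ih =>
    have two_mul_add_one_ne : 2 * α * ρ (n + 1) + 1 ≠ 0 := by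
      linarith [hp (n + 1) (by lia) le_rfl]
    rw [Finset.sum_Icc_succ_top (by lia), ih fun m h₁ h₂ => hp m h₁ (by lia), ratioProd_succ,
      Nat.add_sub_cancel, pow_succ]
    field_simp
    ring

lemma varA_add_varB {M : ℕ} (hp : ∀ m, 1 ≤ m → m ≤ M → 0 < α * ρ m) :
    varA α ρ M + varB α ρ M = ∑ m ∈ Finset.range M, ratioProd α ρ m *
      ((α * ρ (m + 1) + 1) / (2 * α * ρ (m + 1) + 1) * lambda5 α ρ (m + 1)
        + α * ρ (m + 1) / (2 * α * ρ (m + 1) + 1) * lambda6 α ρ (m + 1)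
        - lambda2 α ρ (m + 1) ^ 2) := by
  rw [varA, varB, ← Finset.sum_add_distrib, sum_Icc_one_eq_sum_range]
  refine Finset.sum_congr rfl fun m hm => ?_
  have m_lt := Finset.mem_range.1 hm
  have cross_terms : ∑ j ∈ Finset.Icc (m + 1 + 1) M,
      ((α * ρ (m + 1) + 1) / (2 * α * ρ (m + 1) + 1) * lambda3 α ρ (m + 1) * lambda2 α ρ j
        + α * ρ (m + 1) / (2 * α * ρ (m + 1) + 1) * lambda4 α ρ (m + 1) * lambda2 α ρ j
        - lambda2 α ρ (m + 1) * lambda2 α ρ j) = 0 := by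
    refine Finset.sum_eq_zero fun j _ => ?_
    rw [← lambda3_add_lambda4 (hp (m + 1) (by lia) m_lt)]
    ring
  simp only [Nat.add_sub_cancel, cross_terms, ← sub_mul, ← Finset.sum_mul]
  rw [sum_ratioProd_sub_half_pow fun k h₁ h₂ => hp k h₁ (by lia), ratioProd_succ, pow_succ]
  ring

end ClosedForm

section PolyaTree

open scoped ENNReal

variable {Ω : Type*} {M : ℕ} {Y : ℕ → ℕ → Ω → ℝ}

/-- The σ-algebra generated by the branching probabilities below the nodes of the levels `m ∈ s`,
that is, by the variables `Y (m + 1) (2 * i + 1)` with `m < M`, `m ∈ s` and `i < 2 ^ m`. With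
`s = Iio n` it carries the first `n` levels of the tree. -/
abbrev branchingAlgebra (M : ℕ) (Y : ℕ → ℕ → Ω → ℝ) (s : Set ℕ) : MeasurableSpace Ω :=
  ⨆ p ∈ {p : Σ m : Fin M, Fin (2 ^ (m : ℕ)) | (p.1 : ℕ) ∈ s},
    MeasurableSpace.comap (Y ((p.1 : ℕ) + 1) (2 * (p.2 : ℕ) + 1)) inferInstance

lemma branchingAlgebra_mono {s t : Set ℕ} (hst : s ⊆ t) :
    branchingAlgebra M Y s ≤ branchingAlgebra M Y t :=
  biSup_mono fun _ hp => hst hp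

lemma measurable_branchingAlgebra {s : Set ℕ} {m i : ℕ} (hm : m < M) (hi : i < 2 ^ m)
    (hs : m ∈ s) : Measurable[branchingAlgebra M Y s] (Y (m + 1) (2 * i + 1)) := by
  have comap_le : MeasurableSpace.comap (Y (m + 1) (2 * i + 1)) inferInstance
      ≤ branchingAlgebra M Y s :=
    le_iSup₂_of_le (f := fun (p : Σ m : Fin M, Fin (2 ^ (m : ℕ)))
      (_ : p ∈ {p : Σ m : Fin M, Fin (2 ^ (m : ℕ)) | (p.1 : ℕ) ∈ s}) =>
      MeasurableSpace.comap (Y ((p.1 : ℕ) + 1) (2 * (p.2 : ℕ) + 1)) inferInstance)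
      ⟨⟨m, hm⟩, ⟨i, hi⟩⟩ hs le_rfl
  exact (comap_measurable _).mono comap_le le_rfl

variable [mΩ : MeasurableSpace Ω] {P : Measure Ω} {α : ℝ} {ρ : ℕ → ℝ} {F₀ : Measure ℝ}
  {f₀ : ℝ → ℝ} {F : Ω → Measure ℝ}

namespace IsFinitePolyaTree

lemma isBranching (hF : IsFinitePolyaTree P M α ρ F₀ f₀ Y F) (ω : Ω) :
    IsBranching M (Y · · ω) :=
  fun m hm i hi => hF.right ⟨⟨m, hm⟩, ⟨i, hi⟩⟩ ω

lemma branchingAlgebra_le (hF : IsFinitePolyaTree P M α ρ F₀ f₀ Y F) (s : Set ℕ) :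
    branchingAlgebra M Y s ≤ mΩ :=
  iSup₂_le fun p _ => (hF.measurable_left p).comap_le

lemma indep_branchingAlgebra (hF : IsFinitePolyaTree P M α ρ F₀ f₀ Y F) (n : ℕ) :
    Indep (branchingAlgebra M Y (Iio n)) (branchingAlgebra M Y {n}) P :=
  indep_iSup_of_disjoint (fun p => (hF.measurable_left p).comap_le)
    ((iIndepFun_iff_iIndep _ _ _).1 hF.indep)
    (Set.disjoint_left.2 fun _ lt_n eq_n => lt_n.ne eq_n)

section Branching

variable {m i : ℕ}

lemma measurable_branching (hF : IsFinitePolyaTree P M α ρ F₀ f₀ Y F) (hm : m < M)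
    (hi : i < 2 ^ m) : Measurable (Y (m + 1) (2 * i + 1)) :=
  hF.measurable_left ⟨⟨m, hm⟩, ⟨i, hi⟩⟩

lemma map_branching (hF : IsFinitePolyaTree P M α ρ F₀ f₀ Y F) (hm : m < M) (hi : i < 2 ^ m) :
    P.map (Y (m + 1) (2 * i + 1)) = betaMeasure (α * ρ (m + 1)) (α * ρ (m + 1)) :=
  hF.law ⟨⟨m, hm⟩, ⟨i, hi⟩⟩

lemma indepFun_branching (hF : IsFinitePolyaTree P M α ρ F₀ f₀ Y F) (hm : m < M) {k : ℕ}
    (hi : i < 2 ^ m) (hk : k < 2 ^ m) (hik : i ≠ k) :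
    IndepFun (Y (m + 1) (2 * i + 1)) (Y (m + 1) (2 * k + 1)) P :=
  hF.indep.indepFun (i := ⟨⟨m, hm⟩, ⟨i, hi⟩⟩) (j := ⟨⟨m, hm⟩, ⟨k, hk⟩⟩) (by simpa using hik)

lemma integral_comp_branching (hF : IsFinitePolyaTree P M α ρ F₀ f₀ Y F) (hm : m < M)
    (hi : i < 2 ^ m) {g : ℝ → ℝ} (hg : Measurable g) :
    ∫ ω, g (Y (m + 1) (2 * i + 1) ω) ∂P
      = ∫ x, g x ∂betaMeasure (α * ρ (m + 1)) (α * ρ (m + 1)) := by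
  rw [← hF.map_branching hm hi, integral_map (hF.measurable_branching hm hi).aemeasurable
    hg.aestronglyMeasurable]

lemma ae_branching_mem_Ioo (hF : IsFinitePolyaTree P M α ρ F₀ f₀ Y F) (hm : m < M)
    (hi : i < 2 ^ m) : ∀ᵐ ω ∂P, Y (m + 1) (2 * i + 1) ω ∈ Ioo (0 : ℝ) 1 := by
  refine ae_of_ae_map (hF.measurable_branching hm hi).aemeasurable ?_
  rw [hF.map_branching hm hi]
  exact ae_mem_Ioo_betaMeasure _ _

lemma ae_forall_branching_mem_Icc (hF : IsFinitePolyaTree P M α ρ F₀ f₀ Y F) :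
    ∀ᵐ ω ∂P, ∀ m < M, ∀ i < 2 ^ m, Y (m + 1) (2 * i + 1) ω ∈ Icc (0 : ℝ) 1 := by
  simp only [ae_all_iff, eventually_imp_distrib_left]
  exact fun m hm i hi => (hF.ae_branching_mem_Ioo hm hi).mono fun _ h => Ioo_subset_Icc_self h

lemma memLp_comp_branching [IsFiniteMeasure P] (hF : IsFinitePolyaTree P M α ρ F₀ f₀ Y F)
    (hm : m < M) (hi : i < 2 ^ m) {g : ℝ → ℝ} (hg : Continuous g) (p : ℝ≥0∞) :
    MemLp (fun ω => g (Y (m + 1) (2 * i + 1) ω)) p P := by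
  obtain ⟨C, norm_le⟩ := isCompact_Icc.exists_bound_of_continuousOn (s := Icc (0 : ℝ) 1)
    hg.continuousOn
  exact MemLp.of_bound
    (hg.measurable.comp (hF.measurable_branching hm hi)).aestronglyMeasurable C
    ((hF.ae_branching_mem_Ioo hm hi).mono fun ω hω => norm_le _ (Ioo_subset_Icc_self hω))

lemma integral_binEntropy_branching (hF : IsFinitePolyaTree P M α ρ F₀ f₀ Y F) (hm : m < M)
    (ha : 0 < α * ρ (m + 1)) (hi : i < 2 ^ m) :
    ∫ ω, Real.binEntropy (Y (m + 1) (2 * i + 1) ω) ∂P = -lambda2 α ρ (m + 1) := by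
  rw [hF.integral_comp_branching hm hi Real.binEntropy_continuous.measurable,
    integral_binEntropy_betaMeasure ha, lambda2, mul_assoc]

lemma variance_binEntropy_branching [IsProbabilityMeasure P]
    (hF : IsFinitePolyaTree P M α ρ F₀ f₀ Y F) (hm : m < M) (ha : 0 < α * ρ (m + 1))
    (hi : i < 2 ^ m) :
    Var[fun ω => Real.binEntropy (Y (m + 1) (2 * i + 1) ω); P]
      = (α * ρ (m + 1) + 1) / (2 * α * ρ (m + 1) + 1) * lambda5 α ρ (m + 1)
        + α * ρ (m + 1) / (2 * α * ρ (m + 1) + 1) * lambda6 α ρ (m + 1)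
        - lambda2 α ρ (m + 1) ^ 2 := by
  rw [variance_eq_sub (hF.memLp_comp_branching hm hi Real.binEntropy_continuous 2),
    hF.integral_binEntropy_branching hm ha hi, neg_sq]
  simp only [Pi.pow_apply]
  rw [hF.integral_comp_branching hm hi (g := fun x => Real.binEntropy x ^ 2)
      (Real.binEntropy_continuous.measurable.pow_const 2),
    integral_binEntropy_sq_betaMeasure ha, lambda5, lambda6, mul_assoc]

end Branching

section NodeMass

variable {n : ℕ}

lemma measurable_nodeMass (hF : IsFinitePolyaTree P M α ρ F₀ f₀ Y F) (hn : n ≤ M) :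
    ∀ i < 2 ^ n, Measurable[branchingAlgebra M Y (Iio n)]
      fun ω => nodeMass (Y · · ω) n (i + 1) := by
  induction n with
  | zero => simp only [nodeMass_zero, measurable_const, implies_true]
  | succ n ih =>
    rw [forall_lt_two_pow_succ]
    intro i hi
    have measurable_parent := (ih (by lia) i hi).mono
      (branchingAlgebra_mono (Iio_subset_Iio n.le_succ)) le_rfl
    have measurable_left := measurable_branchingAlgebra (Y := Y) hn hi (mem_Iio.2 n.lt_succ_self)
    have right_eq (ω) := hF.isBranching ω n hn i hi
    simp only [nodeMass_succ_left, nodeMass_succ_right, right_eq]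
    exact ⟨measurable_parent.mul measurable_left,
      measurable_parent.mul (measurable_const.sub measurable_left)⟩

lemma memLp_nodeMass [IsFiniteMeasure P] (hF : IsFinitePolyaTree P M α ρ F₀ f₀ Y F)
    (hn : n ≤ M) {i : ℕ} (hi : i < 2 ^ n) (p : ℝ≥0∞) :
    MemLp (fun ω => nodeMass (Y · · ω) n (i + 1)) p P := by
  refine MemLp.of_bound ((hF.measurable_nodeMass hn i hi).mono
    (hF.branchingAlgebra_le _) le_rfl).aestronglyMeasurable 1 ?_
  filter_upwards [hF.ae_forall_branching_mem_Icc] with ω mem_Icc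
  have branching := (hF.isBranching ω).mono hn
  have nonneg := branching.nodeMass_nonneg fun m hm => mem_Icc m (hm.trans_le hn)
  rw [Real.norm_of_nonneg (nonneg i hi), ← branching.sum_nodeMass]
  exact Finset.single_le_sum (f := fun i => nodeMass (Y · · ω) n (i + 1))
    (fun k hk => nonneg k (Finset.mem_range.1 hk)) (Finset.mem_range.2 hi)

lemma integral_nodeMass_succ_sq [IsFiniteMeasure P]
    (hF : IsFinitePolyaTree P M α ρ F₀ f₀ Y F) (hn : n < M) (ha : 0 < α * ρ (n + 1)) {i : ℕ}
    (hi : i < 2 ^ n) :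
    ∫ ω, nodeMass (Y · · ω) (n + 1) (2 * i + 1) ^ 2 ∂P
        + ∫ ω, nodeMass (Y · · ω) (n + 1) (2 * i + 2) ^ 2 ∂P
      = (∫ ω, nodeMass (Y · · ω) n (i + 1) ^ 2 ∂P)
        * ((α * ρ (n + 1) + 1) / (2 * α * ρ (n + 1) + 1)) := by
  have children := forall_lt_two_pow_succ.1
    (fun k hk => (hF.memLp_nodeMass hn hk 2).integrable_sq) i hi
  have sum_sq (ω) : nodeMass (Y · · ω) (n + 1) (2 * i + 1) ^ 2
        + nodeMass (Y · · ω) (n + 1) (2 * i + 2) ^ 2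
      = nodeMass (Y · · ω) n (i + 1) ^ 2
        * (Y (n + 1) (2 * i + 1) ω ^ 2 + (1 - Y (n + 1) (2 * i + 1) ω) ^ 2) := by
    have right_eq : Y (n + 1) (2 * i + 2) ω = 1 - Y (n + 1) (2 * i + 1) ω :=
      hF.isBranching ω n hn i hi
    rw [nodeMass_succ_left, nodeMass_succ_right, right_eq]
    ring
  have measurable_sq_add : Measurable fun x : ℝ => x ^ 2 + (1 - x) ^ 2 := by fun_prop
  have indep : IndepFun (fun ω => nodeMass (Y · · ω) n (i + 1) ^ 2)
      (fun ω => Y (n + 1) (2 * i + 1) ω ^ 2 + (1 - Y (n + 1) (2 * i + 1) ω) ^ 2) P :=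
    indepFun_of_indep (hF.indep_branchingAlgebra n)
      ((hF.measurable_nodeMass hn.le i hi).pow_const 2)
      (measurable_sq_add.comp (measurable_branchingAlgebra hn hi rfl))
  rw [← integral_add children.1 children.2]
  simp only [sum_sq]
  rw [indep.integral_fun_mul_eq_mul_integral
      (hF.memLp_nodeMass hn.le hi 2).integrable_sq.aestronglyMeasurable
      (measurable_sq_add.comp (hF.measurable_branching hn hi)).aestronglyMeasurable,
    hF.integral_comp_branching hn hi measurable_sq_add, integral_sq_add_one_sub_sq_betaMeasure ha,
    ← mul_assoc]

variable [IsProbabilityMeasure P]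

lemma sum_integral_nodeMass_sq (hF : IsFinitePolyaTree P M α ρ F₀ f₀ Y F)
    (hp : ∀ m, 1 ≤ m → m ≤ M → 0 < α * ρ m) (hn : n ≤ M) :
    ∑ i ∈ Finset.range (2 ^ n), ∫ ω, nodeMass (Y · · ω) n (i + 1) ^ 2 ∂P = ratioProd α ρ n := by
  induction n with
  | zero => simp [nodeMass_zero, ratioProd_zero]
  | succ n ih =>
    rw [ratioProd_succ, ← ih (by lia), sum_range_two_pow_succ, Finset.sum_mul]
    exact Finset.sum_congr rfl fun i hi =>
      hF.integral_nodeMass_succ_sq hn (hp (n + 1) (by lia) hn) (Finset.mem_range.1 hi)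

end NodeMass

section LevelEntropy

variable {m n : ℕ}

lemma measurable_levelEntropy (hF : IsFinitePolyaTree P M α ρ F₀ f₀ Y F) (hmn : m < n)
    (hn : n ≤ M) :
    Measurable[branchingAlgebra M Y (Iio n)] fun ω => levelEntropy (Y · · ω) m := by
  refine Finset.measurable_fun_sum _ fun i hi => ?_
  have hi := Finset.mem_range.1 hi
  exact ((hF.measurable_nodeMass (by lia) i hi).mono
      (branchingAlgebra_mono (Iio_subset_Iio hmn.le)) le_rfl).mul
    (Real.binEntropy_continuous.measurable.comp
      (measurable_branchingAlgebra (by lia) hi (mem_Iio.2 hmn)))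

lemma memLp_levelEntropy [IsFiniteMeasure P] (hF : IsFinitePolyaTree P M α ρ F₀ f₀ Y F)
    (hm : m < M) (p : ℝ≥0∞) :
    MemLp (fun ω => levelEntropy (Y · · ω) m) p P :=
  memLp_finsetSum _ fun _ hi =>
    (hF.memLp_comp_branching hm (Finset.mem_range.1 hi) Real.binEntropy_continuous p).mul
      (hF.memLp_nodeMass hm.le (Finset.mem_range.1 hi) ∞)

lemma integral_mul_levelEntropy [IsFiniteMeasure P]
    (hF : IsFinitePolyaTree P M α ρ F₀ f₀ Y F) (hn : n < M) (ha : 0 < α * ρ (n + 1)) {Z : Ω → ℝ}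
    (hZ : Measurable[branchingAlgebra M Y (Iio n)] Z) (integrable_Z : Integrable Z P) :
    ∫ ω, Z ω * levelEntropy (Y · · ω) n ∂P = -lambda2 α ρ (n + 1) * ∫ ω, Z ω ∂P := by
  refine integral_mul_convexCombination (hF.indep_branchingAlgebra n) hZ
    (fun i hi => hF.measurable_nodeMass hn.le i (Finset.mem_range.1 hi))
    (fun i hi => Real.binEntropy_continuous.measurable.comp
      (measurable_branchingAlgebra hn (Finset.mem_range.1 hi) rfl))
    (fun i hi => ?_)
    (fun i hi => (hF.memLp_comp_branching hn (Finset.mem_range.1 hi)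
      Real.binEntropy_continuous 1).integrable le_rfl)
    (fun ω => ((hF.isBranching ω).mono hn.le).sum_nodeMass)
    fun i hi => hF.integral_binEntropy_branching hn ha (Finset.mem_range.1 hi)
  exact integrable_Z.mul_of_top_left (hF.memLp_nodeMass hn.le (Finset.mem_range.1 hi) ∞)

variable [IsProbabilityMeasure P]

lemma integral_levelEntropy (hF : IsFinitePolyaTree P M α ρ F₀ f₀ Y F) (hn : n < M)
    (ha : 0 < α * ρ (n + 1)) :
    ∫ ω, levelEntropy (Y · · ω) n ∂P = -lambda2 α ρ (n + 1) := by
  simpa using hF.integral_mul_levelEntropy hn ha (Z := fun _ => 1) measurable_const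
    (integrable_const 1)

lemma covariance_levelEntropy_of_lt (hF : IsFinitePolyaTree P M α ρ F₀ f₀ Y F) (hmn : m < n)
    (hn : n < M) (ha : 0 < α * ρ (n + 1)) :
    cov[fun ω => levelEntropy (Y · · ω) m, fun ω => levelEntropy (Y · · ω) n; P] = 0 := by
  have memLp_m := hF.memLp_levelEntropy (hmn.trans hn) 2
  rw [covariance_eq_sub memLp_m (hF.memLp_levelEntropy hn 2), hF.integral_levelEntropy hn ha]
  refine sub_eq_zero.2 ((hF.integral_mul_levelEntropy hn ha (hF.measurable_levelEntropy hmn hn.le)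
    (memLp_m.integrable one_le_two)).trans (mul_comm _ _))

lemma covariance_levelEntropy (hF : IsFinitePolyaTree P M α ρ F₀ f₀ Y F)
    (hp : ∀ m, 1 ≤ m → m ≤ M → 0 < α * ρ m) (hm : m < M) (hn : n < M) (hmn : m ≠ n) :
    cov[fun ω => levelEntropy (Y · · ω) m, fun ω => levelEntropy (Y · · ω) n; P] = 0 := by
  rcases hmn.lt_or_gt with h | h
  · exact hF.covariance_levelEntropy_of_lt h hn (hp (n + 1) (by lia) hn)
  · rw [covariance_comm]
    exact hF.covariance_levelEntropy_of_lt h hm (hp (m + 1) (by lia) hm)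

lemma variance_levelEntropy (hF : IsFinitePolyaTree P M α ρ F₀ f₀ Y F)
    (hp : ∀ m, 1 ≤ m → m ≤ M → 0 < α * ρ m) (hn : n < M) :
    Var[fun ω => levelEntropy (Y · · ω) n; P] = ratioProd α ρ n *
      ((α * ρ (n + 1) + 1) / (2 * α * ρ (n + 1) + 1) * lambda5 α ρ (n + 1)
        + α * ρ (n + 1) / (2 * α * ρ (n + 1) + 1) * lambda6 α ρ (n + 1)
        - lambda2 α ρ (n + 1) ^ 2) := by
  have ha := hp (n + 1) (by lia) hn
  have memLp_binEntropy (i) (hi : i ∈ Finset.range (2 ^ n)) :=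
    hF.memLp_comp_branching hn (Finset.mem_range.1 hi) Real.binEntropy_continuous 2
  rw [← hF.sum_integral_nodeMass_sq hp hn.le, mul_comm]
  refine variance_convexCombination (hF.indep_branchingAlgebra n)
    (fun i hi => hF.measurable_nodeMass hn.le i (Finset.mem_range.1 hi))
    (fun i hi => Real.binEntropy_continuous.measurable.comp
      (measurable_branchingAlgebra hn (Finset.mem_range.1 hi) rfl))
    (fun i hi => hF.memLp_nodeMass hn.le (Finset.mem_range.1 hi) 2) memLp_binEntropy
    (fun ω => ((hF.isBranching ω).mono hn.le).sum_nodeMass)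
    (fun i hi => hF.integral_binEntropy_branching hn ha (Finset.mem_range.1 hi))
    (fun i hi => hF.variance_binEntropy_branching hn ha (Finset.mem_range.1 hi))
    fun i hi k hk hik => ?_
  have measurable_binEntropy := Real.binEntropy_continuous.measurable
  exact ((hF.indepFun_branching hn (Finset.mem_range.1 hi) (Finset.mem_range.1 hk) hik).comp
    measurable_binEntropy measurable_binEntropy).covariance_eq_zero
    (memLp_binEntropy i hi) (memLp_binEntropy k hk)

end LevelEntropy

section ReverseKLSum

lemma reverseKLSum_eq (hF : IsFinitePolyaTree P M α ρ F₀ f₀ Y F) :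
    (fun ω => reverseKLSum M (Y · · ω))
      = fun ω => M * Real.log 2 - ∑ m ∈ Finset.range M, levelEntropy (Y · · ω) m :=
  funext fun ω => (hF.isBranching ω).reverseKLSum_eq

lemma memLp_reverseKLSum [IsFiniteMeasure P] (hF : IsFinitePolyaTree P M α ρ F₀ f₀ Y F)
    (p : ℝ≥0∞) :
    MemLp (fun ω => reverseKLSum M (Y · · ω)) p P := by
  rw [hF.reverseKLSum_eq]
  exact (memLp_const _).sub
    (memLp_finsetSum _ fun m hm => hF.memLp_levelEntropy (Finset.mem_range.1 hm) p)

variable [IsProbabilityMeasure P]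

lemma integral_reverseKLSum (hF : IsFinitePolyaTree P M α ρ F₀ f₀ Y F)
    (hp : ∀ m, 1 ≤ m → m ≤ M → 0 < α * ρ m) :
    ∫ ω, reverseKLSum M (Y · · ω) ∂P = ∑ m ∈ Finset.Icc 1 M, (lambda2 α ρ m + Real.log 2) := by
  have integrable_levelEntropy (m) (hm : m ∈ Finset.range M) :=
    (hF.memLp_levelEntropy (Finset.mem_range.1 hm) 1).integrable le_rfl
  have integral_eq (m) (hm : m ∈ Finset.range M) :
      ∫ ω, levelEntropy (Y · · ω) m ∂P = -lambda2 α ρ (m + 1) :=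
    have m_lt := Finset.mem_range.1 hm
    hF.integral_levelEntropy m_lt (hp (m + 1) (by lia) m_lt)
  rw [hF.reverseKLSum_eq, integral_sub (integrable_const _)
      (integrable_finsetSum _ integrable_levelEntropy),
    integral_finsetSum _ integrable_levelEntropy, Finset.sum_congr rfl integral_eq,
    sum_Icc_one_eq_sum_range, Finset.sum_neg_distrib, Finset.sum_add_distrib, integral_const,
    probReal_univ, one_smul, Finset.sum_const, Finset.card_range, nsmul_eq_mul, sub_neg_eq_add,
    add_comm]

lemma variance_reverseKLSum (hF : IsFinitePolyaTree P M α ρ F₀ f₀ Y F)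
    (hp : ∀ m, 1 ≤ m → m ≤ M → 0 < α * ρ m) :
    Var[fun ω => reverseKLSum M (Y · · ω); P] = varA α ρ M + varB α ρ M := by
  have memLp (m) (hm : m ∈ Finset.range M) :=
    hF.memLp_levelEntropy (Finset.mem_range.1 hm) 2
  rw [hF.reverseKLSum_eq, variance_const_sub (memLp_finsetSum _ memLp).aestronglyMeasurable,
    variance_fun_sum' memLp, varA_add_varB hp]
  refine Finset.sum_congr rfl fun m hm => ?_
  rw [Finset.sum_eq_single_of_mem m hm fun n hn hnm =>
      hF.covariance_levelEntropy hp (Finset.mem_range.1 hm) (Finset.mem_range.1 hn) hnm.symm,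
    covariance_self (memLp m hm).aemeasurable, hF.variance_levelEntropy hp (Finset.mem_range.1 hm)]

end ReverseKLSum

lemma ae_integrable_and_kl_eq [IsProbabilityMeasure F₀]
    (hF : IsFinitePolyaTree P M α ρ F₀ f₀ Y F) (hf₀ : IsDensity f₀ F₀) {f : Ω → ℝ → ℝ}
    (hf : ∀ᵐ ω ∂P, IsDensity (f ω) (F ω)) :
    ∀ᵐ ω ∂P, Integrable (klIntegrand (f ω) f₀) ∧ kl (f ω) f₀ = reverseKLSum M (Y · · ω) := by
  filter_upwards [hf, hF.density, hF.ae_forall_branching_mem_Icc] with ω density_f F_eq mem_Icc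
  have density_tree := isDensity_treeDensity hf₀ (hF.isBranching ω) mem_Icc
  have klIntegrand_ae_eq :
      klIntegrand (f ω) f₀ =ᵐ[volume] klIntegrand (treeDensity M F₀ f₀ (Y · · ω)) f₀ :=
    (density_f.ae_eq (F_eq ▸ density_tree)).mono fun x hx => by rw [klIntegrand, klIntegrand, hx]
  exact ⟨(integrable_klIntegrand_treeDensity hf₀).congr klIntegrand_ae_eq.symm,
    (integral_congr_ae klIntegrand_ae_eq).trans (kl_treeDensity hf₀ (hF.isBranching ω))⟩

end IsFinitePolyaTree

end PolyaTree

end PolyaKL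

theorem mainTheorem3 {Ω : Type*} [MeasurableSpace Ω] (P : Measure Ω) [IsProbabilityMeasure P]
    (M : ℕ) (α : ℝ) (hα : 0 < α) (ρ : ℕ → ℝ) (hρ : ∀ m, 1 ≤ m → m ≤ M → 0 < ρ m)
    (F₀ : Measure ℝ) [IsProbabilityMeasure F₀] (f₀ : ℝ → ℝ) (hf₀ : PolyaKL.IsDensity f₀ F₀)
    (Y : ℕ → ℕ → Ω → ℝ) (F : Ω → Measure ℝ)
    (hF : PolyaKL.IsFinitePolyaTree P M α ρ F₀ f₀ Y F)
    (f : Ω → ℝ → ℝ) (hf : ∀ᵐ ω ∂P, PolyaKL.IsDensity (f ω) (F ω)) :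
    (∀ᵐ ω ∂P, Integrable (PolyaKL.klIntegrand (f ω) f₀) volume ∧
      PolyaKL.kl (f ω) f₀ = PolyaKL.reverseKLSum M (fun m j => Y m j ω)) ∧
    MemLp (fun ω => PolyaKL.kl (f ω) f₀) 2 P ∧
    ∫ ω, PolyaKL.kl (f ω) f₀ ∂P =
      ∑ m ∈ Finset.Icc 1 M, (PolyaKL.digamma (α * ρ m + 1)
        - PolyaKL.digamma (2 * α * ρ m + 1) + Real.log 2) ∧
    variance (fun ω => PolyaKL.kl (f ω) f₀) P = PolyaKL.varA α ρ M + PolyaKL.varB α ρ M := by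
  have hp (m : ℕ) (one_le : 1 ≤ m) (le_M : m ≤ M) : 0 < α * ρ m := mul_pos hα (hρ m one_le le_M)
  have kl_eq := hF.ae_integrable_and_kl_eq hf₀ hf
  have kl_ae_eq : (fun ω => PolyaKL.kl (f ω) f₀)
      =ᵐ[P] fun ω => PolyaKL.reverseKLSum M (fun m j => Y m j ω) := kl_eq.mono fun _ h => h.2
  exact ⟨kl_eq, (memLp_congr_ae kl_ae_eq).2 (hF.memLp_reverseKLSum 2),
    (integral_congr_ae kl_ae_eq).trans (hF.integral_reverseKLSum hp),
    (variance_congr kl_ae_eq).trans (hF.variance_reverseKLSum hp)⟩
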